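/- Let $p>1$ and consider, for $\mu>0$ and $v\in C^2([0,1])$, the problem $$-v''(x)=\mu\,(v(x)^p+v(x)\sin^2v(x)),\quad v(x)>0\quad(0<x<1),\qquad v(0)=v(1)=0. \tag{P}$$ For a real number $\alpha>0$ put $$C_0=\int_0^1\frac{ds}{\sqrt{1-s^{p+1}}},\qquad C_1=-\frac{p+1}{8}\int_0^1\frac{1-s^2}{(1-s^{p+1})^{3/2}}\,ds,\qquad C_2=\frac{3(p+1)^2}{128}\int_0^1\frac{(1-s^2)^2}{(1-s^{p+1})^{5/2}}\,ds,$$ $$C_{11}=\frac{2}{p+1}\int_0^{\pi/2}\cos(2\alpha\sin^{2/(p+1)}\theta)\,\sin^{(3-p)/(p+1)}\theta\,d\theta,$$ $$C_{12}=\frac{p-1}{2(p+1)}\int_0^{\pi/2}\bigl(\sin2\alpha-\sin(2\alpha\sin^{2/(p+1)}\theta)\bigr)\sin^{(1-p)/(p+1)}\theta\,d\theta+\frac{p+1}{4}\int_0^1\frac{1-s}{(1-s^{p+1})^{3/2}}\sin(2\alpha s)\,ds,$$ $$C_{21}=-\frac1{p+1}\int_0^{\pi/2}\sin(2\alpha\sin^{2/(p+1)}\theta)\,\sin^{(3-p)/(p+1)}\theta\,d\theta,$$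 $$C_3=-\frac{3(p+1)^2}{32}\int_0^1\Bigl(\int_0^s\frac{1-y^2}{(1-y^{p+1})^{5/2}}\,dy\Bigr)\cos(2\alpha s)\,ds,$$ $$E_0=\int_0^1\sqrt{1-s^{p+1}}\,ds,\qquad E_1=\frac{p+1}{8}\int_0^1\frac{1-s^2}{\sqrt{1-s^{p+1}}}\,ds,\qquad E_4=-\frac{(p+1)^2}{128}\int_0^1\frac{(1-s^2)^2}{(1-s^{p+1})^{3/2}}\,ds,$$ $$E_2=-\frac14\int_0^{\pi/2}\bigl(\sin2\alpha-\sin^{2/(p+1)}\theta\,\sin(2\alpha\sin^{2/(p+1)}\theta)\bigr)\sin^{(1-p)/(p+1)}\theta\,d\theta,$$ and $$G_0=C_0E_0,\qquad G_1=C_0E_1+\bigl(C_1+\tfrac12C_{11}\bigr)E_0,\qquad G_2=\tfrac12(C_{12}+C_{21})E_0+C_0E_2,$$ $$G_4=(C_2+C_3)E_0+C_0E_4+\bigl(C_1+\tfrac12C_{11}\bigr)E_1$$ (so $G_1,G_2,G_4$ depend on $p$ and $\alpha$, and $G_0$ on $p$ only). **Theorem 1.5.** Let $1<p\le2$. For every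 $\alpha>0$ problem (P) has a solution pair $(\mu,v_\alpha)$ with $\|v_\alpha\|_\infty=\alpha$. Moreover, the following hold for every such solution, with a remainder that depends only on $p$ and $\alpha$. (i) If $1<p<2$, then as $\alpha\to\infty$, $$\|v_\alpha'\|_2^2=4\alpha^2\bigl\{G_0+G_1\alpha^{1-p}+G_4\alpha^{2(1-p)}+G_2\alpha^{-p}+o(\alpha^{2(1-p)})\bigr\}.$$ (ii) If $p=2$, then as $\alpha\to\infty$, $$\|v_\alpha'\|_2^2=4\alpha^2\bigl\{G_0+G_1\alpha^{-1}+(G_2+G_4)\alpha^{-2}+o(\alpha^{-2})\bigr\}.$$ -/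

import Mathlib

open Set Filter Topology Asymptotics

namespace OscBif

/-- `(μ, v)` is a solution pair of
`-v'' = μ (v ^ p + v sin² v)` and `v > 0` on `(0,1)`, `v(0) = v(1) = 0`,
with `μ > 0` and `v` of class `C²` on the closed interval `[0,1]`.
Only the values of `v` on `[0,1]` matter. -/
structure IsSolution (p μ : ℝ) (v : ℝ → ℝ) : Prop where
  mu_pos : 0 < μ
  contDiffOn : ContDiffOn ℝ 2 v (Icc 0 1)
  equation : ∀ x ∈ Ioo (0 : ℝ) 1,
    -deriv (deriv v) x = μ * (v x ^ p + v x * Real.sin (v x) ^ 2)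
  pos : ∀ x ∈ Ioo (0 : ℝ) 1, 0 < v x
  left : v 0 = 0
  right : v 1 = 0

/-- `‖v‖_∞ = α` on `[0,1]`. -/
def HasSupNorm (v : ℝ → ℝ) (α : ℝ) : Prop :=
  IsLUB ((fun x => |v x|) '' Icc (0 : ℝ) 1) α

/-- `‖v'‖₂²` on `(0,1)`. -/
noncomputable def energy (v : ℝ → ℝ) : ℝ :=
  ∫ x in (0 : ℝ)..1, (deriv v x) ^ 2

/-! The coefficients. Those that oscillate take `α` as an argument. -/

noncomputable def C0 (p : ℝ) : ℝ :=
  ∫ s in (0 : ℝ)..1, 1 / √(1 - s ^ (p + 1))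

noncomputable def C1 (p : ℝ) : ℝ :=
  -((p + 1) / 8) * ∫ s in (0 : ℝ)..1, (1 - s ^ 2) / (1 - s ^ (p + 1)) ^ (3 / 2 : ℝ)

noncomputable def C11 (p α : ℝ) : ℝ :=
  2 / (p + 1) * ∫ θ in (0 : ℝ)..(Real.pi / 2),
    Real.cos (2 * α * Real.sin θ ^ (2 / (p + 1))) * Real.sin θ ^ ((3 - p) / (p + 1))

noncomputable def C12 (p α : ℝ) : ℝ :=
  (p - 1) / (2 * (p + 1)) * (∫ θ in (0 : ℝ)..(Real.pi / 2),
    (Real.sin (2 * α) - Real.sin (2 * α * Real.sin θ ^ (2 / (p + 1)))) *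
      Real.sin θ ^ ((1 - p) / (p + 1)))
  + (p + 1) / 4 * ∫ s in (0 : ℝ)..1,
    (1 - s) / (1 - s ^ (p + 1)) ^ (3 / 2 : ℝ) * Real.sin (2 * α * s)

noncomputable def C21 (p α : ℝ) : ℝ :=
  -(1 / (p + 1)) * ∫ θ in (0 : ℝ)..(Real.pi / 2),
    Real.sin (2 * α * Real.sin θ ^ (2 / (p + 1))) * Real.sin θ ^ ((3 - p) / (p + 1))

noncomputable def C2 (p : ℝ) : ℝ :=
  3 * (p + 1) ^ 2 / 128 *
    ∫ s in (0 : ℝ)..1, (1 - s ^ 2) ^ 2 / (1 - s ^ (p + 1)) ^ (5 / 2 : ℝ)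

noncomputable def C3 (p α : ℝ) : ℝ :=
  -(3 / 32) * (p + 1) ^ 2 * ∫ s in (0 : ℝ)..1,
    (∫ y in (0 : ℝ)..s, (1 - y ^ 2) / (1 - y ^ (p + 1)) ^ (5 / 2 : ℝ)) * Real.cos (2 * α * s)

noncomputable def E0 (p : ℝ) : ℝ :=
  ∫ s in (0 : ℝ)..1, √(1 - s ^ (p + 1))

noncomputable def E1 (p : ℝ) : ℝ :=
  (p + 1) / 8 * ∫ s in (0 : ℝ)..1, (1 - s ^ 2) / √(1 - s ^ (p + 1))

noncomputable def E2 (p α : ℝ) : ℝ :=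
  -(1 / 4) * ∫ θ in (0 : ℝ)..(Real.pi / 2),
    (Real.sin (2 * α) -
        Real.sin θ ^ (2 / (p + 1)) * Real.sin (2 * α * Real.sin θ ^ (2 / (p + 1)))) *
      Real.sin θ ^ ((1 - p) / (p + 1))

noncomputable def E4 (p : ℝ) : ℝ :=
  -((p + 1) ^ 2 / 128) *
    ∫ s in (0 : ℝ)..1, (1 - s ^ 2) ^ 2 / (1 - s ^ (p + 1)) ^ (3 / 2 : ℝ)

noncomputable def G0 (p : ℝ) : ℝ := C0 p * E0 p

noncomputable def G1 (p α : ℝ) : ℝ :=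
  C0 p * E1 p + (C1 p + 1 / 2 * C11 p α) * E0 p

noncomputable def G2 (p α : ℝ) : ℝ :=
  1 / 2 * (C12 p α + C21 p α) * E0 p + C0 p * E2 p α

noncomputable def G4 (p α : ℝ) : ℝ :=
  (C2 p + C3 p α) * E0 p + C0 p * E4 p + (C1 p + 1 / 2 * C11 p α) * E1 p

end OscBif

/-
With `F` a primitive of the nonlinearity, `v' ^ 2 / 2 + μ * F v` is conserved, so `v` is symmetric
about its maximum and changing variables to `y = v x` on either monotone half gives
`√(2 μ) = 2 ∫₀^α dy / √(F α - F y)` and `‖v'‖₂² = 2 √(2 μ) ∫₀^α √(F α - F y) dy`.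
Eliminating `μ`, the energy is four times a product of two integrals. After the substitution
`y = α s`, their integrands are `1 / √(1 + ε r)` and `√(1 + ε r)` times powers of `1 - s ^ (p + 1)`,
with `ε` of order `α ^ (1 - p)` and `0 ≤ r ≤ 4`, and second order Taylor expansion applies. The
oscillating part of `r` is of order `1 / α`: integrated by parts it produces the terms of order
`α ^ (-p)`, and the Riemann–Lebesgue lemma shows that `C₃` tends to `0`.
-/

namespace OscBif

open MeasureTheory

/-! ### Energy of a positive solution -/

/-- `(μ, v)` is a positive solution of the Dirichlet problem `-v'' = μ f(v)` on `[0,1]`, for a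
general nonlinearity `f`; `IsSolution p` is the case `f = force p`. -/
structure IsPositiveSolution (f : ℝ → ℝ) (μ : ℝ) (v : ℝ → ℝ) : Prop where
  mu_pos : 0 < μ
  contDiffOn : ContDiffOn ℝ 2 v (Icc 0 1)
  equation : ∀ x ∈ Ioo (0 : ℝ) 1, -deriv (deriv v) x = μ * f (v x)
  pos : ∀ x ∈ Ioo (0 : ℝ) 1, 0 < v x
  left : v 0 = 0
  right : v 1 = 0

/-- The time map: for a primitive `F` of `f`, the distance from a zero of a positive solution of
`-w'' = f(w)` to its maximum `α` is `timeMap F α / √2`. -/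
noncomputable def timeMap (F : ℝ → ℝ) (α : ℝ) : ℝ :=
  ∫ y in Ioo 0 α, 1 / √(F α - F y)

/-- The action `∫ w' ^ 2` between a zero and the maximum `α` of a positive solution of
`-w'' = f(w)`, divided by `√2`, for a primitive `F` of `f`. -/
noncomputable def action (F : ℝ → ℝ) (α : ℝ) : ℝ :=
  ∫ y in Ioo 0 α, √(F α - F y)

namespace IsPositiveSolution

variable {f F : ℝ → ℝ} {μ α : ℝ} {v : ℝ → ℝ}

theorem contDiffAt (h : IsPositiveSolution f μ v) {x : ℝ} (hx : x ∈ Ioo (0 : ℝ) 1) :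
    ContDiffAt ℝ 2 v x :=
  (h.contDiffOn x (Ioo_subset_Icc_self hx)).contDiffAt (Icc_mem_nhds hx.1 hx.2)

theorem hasDerivAt (h : IsPositiveSolution f μ v) {x : ℝ} (hx : x ∈ Ioo (0 : ℝ) 1) :
    HasDerivAt v (deriv v x) x :=
  ((h.contDiffAt hx).differentiableAt two_ne_zero).hasDerivAt

theorem hasDerivAt_deriv (h : IsPositiveSolution f μ v) {x : ℝ} (hx : x ∈ Ioo (0 : ℝ) 1) :
    HasDerivAt (deriv v) (-(μ * f (v x))) x := by
  have hC1 : ContDiffAt ℝ 1 (deriv v) x := (h.contDiffAt hx).derivWithin (by norm_num)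
  rw [← h.equation x hx, neg_neg]
  exact (hC1.differentiableAt one_ne_zero).hasDerivAt

theorem nonneg (h : IsPositiveSolution f μ v) {x : ℝ} (hx : x ∈ Icc (0 : ℝ) 1) : 0 ≤ v x := by
  rcases hx.1.eq_or_lt with rfl | h0
  · exact h.left.ge
  rcases hx.2.eq_or_lt with rfl | h1
  · exact h.right.ge
  exact (h.pos x ⟨h0, h1⟩).le

theorem exists_max (h : IsPositiveSolution f μ v) (hv : HasSupNorm v α) :
    ∃ x₀ ∈ Ioo (0 : ℝ) 1, v x₀ = α ∧ deriv v x₀ = 0 := by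
  obtain ⟨x₀, hx₀, hmax⟩ := isCompact_Icc.exists_isMaxOn (nonempty_Icc.2 zero_le_one)
    h.contDiffOn.continuousOn
  have hval : v x₀ = α := by
    refine le_antisymm ((le_abs_self _).trans (hv.1 (mem_image_of_mem _ hx₀))) (hv.2 ?_)
    rintro _ ⟨x, hx, rfl⟩
    simp only [abs_of_nonneg (h.nonneg hx)]
    exact hmax hx
  have hmid : (1 / 2 : ℝ) ∈ Ioo (0 : ℝ) 1 := by constructor <;> norm_num
  have hpos : 0 < v x₀ := (h.pos _ hmid).trans_le (hmax (Ioo_subset_Icc_self hmid))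
  have hx₁ : x₀ ∈ Ioo (0 : ℝ) 1 := by
    refine ⟨hx₀.1.lt_of_ne ?_, hx₀.2.lt_of_ne ?_⟩
    · rintro rfl; exact hpos.ne' h.left
    · rintro rfl; exact hpos.ne' h.right
  exact ⟨x₀, hx₁, hval, (hmax.isLocalMax (Icc_mem_nhds hx₁.1 hx₁.2)).deriv_eq_zero⟩

theorem strictAntiOn_deriv (h : IsPositiveSolution f μ v) (hf : ∀ y, 0 < y → 0 < f y) :
    StrictAntiOn (deriv v) (Ioo 0 1) := by
  refine strictAntiOn_of_deriv_neg (convex_Ioo 0 1)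
    (fun x hx => (h.hasDerivAt_deriv hx).continuousAt.continuousWithinAt) fun x hx => ?_
  rw [interior_Ioo] at hx
  rw [(h.hasDerivAt_deriv hx).deriv]
  exact neg_neg_of_pos (mul_pos h.mu_pos (hf _ (h.pos x hx)))

theorem sq_deriv (h : IsPositiveSolution f μ v) (hF : ∀ y, 0 < y → HasDerivAt F (f y) y)
    {x₀ x : ℝ} (hx₀ : x₀ ∈ Ioo (0 : ℝ) 1) (h0 : deriv v x₀ = 0) (hx : x ∈ Ioo (0 : ℝ) 1) :
    deriv v x ^ 2 = 2 * μ * (F (v x₀) - F (v x)) := by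
  have henergy : ∀ y ∈ Ioo (0 : ℝ) 1,
      HasDerivAt (fun y => deriv v y ^ 2 + 2 * μ * F (v y)) 0 y := by
    intro y hy
    refine (((h.hasDerivAt_deriv hy).pow 2).add
      (((hF _ (h.pos y hy)).comp y (h.hasDerivAt hy)).const_mul (2 * μ))).congr_deriv ?_
    push_cast
    ring
  have hconst := isOpen_Ioo.is_const_of_deriv_eq_zero isPreconnected_Ioo
    (fun y hy => (henergy y hy).differentiableAt.differentiableWithinAt)
    (fun y hy => (henergy y hy).deriv) hx hx₀
  simp only [h0] at hconst
  linarith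

theorem integrableOn_sq_deriv (h : IsPositiveSolution f μ v) :
    IntegrableOn (fun x => deriv v x ^ 2) (Ioo 0 1) := by
  have hcont := (h.contDiffOn.continuousOn_derivWithin uniqueDiffOn_Icc_zero_one one_le_two).pow 2
  refine (hcont.integrableOn_Icc.mono_set Ioo_subset_Icc_self).congr_fun (fun x hx => ?_)
    measurableSet_Ioo
  simp only [Pi.pow_apply, derivWithin_of_mem_nhds (Icc_mem_nhds hx.1 hx.2)]

end IsPositiveSolution

/-- `1 / g ∘ v` and `g ∘ v` integrate to length and action since `dy = g(y) dx` along `v`. -/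
theorem integral_range_of_abs_deriv_eq {v v' g : ℝ → ℝ} {s t : Set ℝ} (hs : MeasurableSet s)
    (hd : ∀ x ∈ s, HasDerivAt v (v' x) x) (hbij : BijOn v s t)
    (hg : ∀ x ∈ s, |v' x| = g (v x)) (hne : ∀ x ∈ s, v' x ≠ 0) :
    ∫ y in t, 1 / g y = volume.real s ∧ ∫ y in t, g y = ∫ x in s, v' x ^ 2 := by
  have hd' : ∀ x ∈ s, HasDerivWithinAt v (v' x) s x := fun x hx => (hd x hx).hasDerivWithinAt
  rw [← hbij.image_eq, integral_image_eq_integral_abs_deriv_smul hs hd' hbij.injOn,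
    integral_image_eq_integral_abs_deriv_smul hs hd' hbij.injOn]
  constructor
  · rw [setIntegral_congr_fun (g := fun _ => (1 : ℝ)) hs fun x hx => by
      simp only [smul_eq_mul, ← hg x hx, mul_one_div, div_self (abs_ne_zero.2 (hne x hx))]]
    simp only [setIntegral_const, smul_eq_mul, mul_one]
  · refine setIntegral_congr_fun hs fun x hx => ?_
    simp only [smul_eq_mul, ← hg x hx, ← sq, sq_abs]

theorem timeMap_action_of_bijOn {F v : ℝ → ℝ} {μ α a b : ℝ} (hμ : 0 < μ) (hab : a ≤ b)
    (hd : ∀ x ∈ Ioo a b, HasDerivAt v (deriv v x) x) (hbij : BijOn v (Ioo a b) (Ioo 0 α))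
    (hsq : ∀ x ∈ Ioo a b, deriv v x ^ 2 = 2 * μ * (F α - F (v x)))
    (hne : ∀ x ∈ Ioo a b, deriv v x ≠ 0) :
    timeMap F α = √(2 * μ) * (b - a) ∧
      ∫ x in a..b, deriv v x ^ 2 = √(2 * μ) * action F α := by
  have h2μ : 0 ≤ 2 * μ := by positivity
  have hK : √(2 * μ) ≠ 0 := by positivity
  obtain ⟨htime, haction⟩ := integral_range_of_abs_deriv_eq (v' := deriv v)
    (g := fun y => √(2 * μ) * √(F α - F y)) measurableSet_Ioo hd hbij
    (fun x hx => by rw [← Real.sqrt_mul h2μ, ← hsq x hx, Real.sqrt_sq_eq_abs]) hne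
  simp only [one_div, mul_inv, integral_const_mul] at htime haction
  rw [Real.volume_real_Ioo_of_le hab] at htime
  rw [intervalIntegral.integral_of_le hab, integral_Ioc_eq_integral_Ioo, ← haction, ← htime]
  simp only [timeMap, action, one_div, mul_inv_cancel_left₀ hK, and_true]

namespace IsPositiveSolution

variable {f F : ℝ → ℝ} {μ α x₀ x : ℝ} {v : ℝ → ℝ}

theorem deriv_pos (h : IsPositiveSolution f μ v) (hf : ∀ y, 0 < y → 0 < f y)
    (hx₀ : x₀ ∈ Ioo (0 : ℝ) 1) (h0 : deriv v x₀ = 0) (hx : x ∈ Ioo 0 x₀) : 0 < deriv v x :=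
  h0 ▸ h.strictAntiOn_deriv hf ⟨hx.1, hx.2.trans hx₀.2⟩ hx₀ hx.2

theorem deriv_neg (h : IsPositiveSolution f μ v) (hf : ∀ y, 0 < y → 0 < f y)
    (hx₀ : x₀ ∈ Ioo (0 : ℝ) 1) (h0 : deriv v x₀ = 0) (hx : x ∈ Ioo x₀ 1) : deriv v x < 0 :=
  h0 ▸ h.strictAntiOn_deriv hf hx₀ ⟨hx₀.1.trans hx.1, hx.2⟩ hx.1

theorem bijOn_left (h : IsPositiveSolution f μ v) (hf : ∀ y, 0 < y → 0 < f y)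
    (hx₀ : x₀ ∈ Ioo (0 : ℝ) 1) (h0 : deriv v x₀ = 0) : BijOn v (Ioo 0 x₀) (Ioo 0 (v x₀)) := by
  have hcont : ContinuousOn v (Icc 0 x₀) :=
    h.contDiffOn.continuousOn.mono (Icc_subset_Icc_right hx₀.2.le)
  have hmono : StrictMonoOn v (Icc 0 x₀) := strictMonoOn_of_deriv_pos (convex_Icc _ _) hcont
    fun x hx => h.deriv_pos hf hx₀ h0 (by rwa [interior_Icc] at hx)
  have := (hmono.injOn.mono Ioo_subset_Icc_self).bijOn_image
  rwa [hcont.image_Ioo_of_strictMonoOn hx₀.1.le hmono, h.left] at this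

theorem bijOn_right (h : IsPositiveSolution f μ v) (hf : ∀ y, 0 < y → 0 < f y)
    (hx₀ : x₀ ∈ Ioo (0 : ℝ) 1) (h0 : deriv v x₀ = 0) : BijOn v (Ioo x₀ 1) (Ioo 0 (v x₀)) := by
  have hcont : ContinuousOn v (Icc x₀ 1) :=
    h.contDiffOn.continuousOn.mono (Icc_subset_Icc_left hx₀.1.le)
  have hanti : StrictAntiOn v (Icc x₀ 1) := strictAntiOn_of_deriv_neg (convex_Icc _ _) hcont
    fun x hx => h.deriv_neg hf hx₀ h0 (by rwa [interior_Icc] at hx)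
  have := (hanti.injOn.mono Ioo_subset_Icc_self).bijOn_image
  rwa [hcont.image_Ioo_of_strictAntiOn hx₀.2.le hanti, h.right] at this

theorem energy_eq (h : IsPositiveSolution f μ v) (hv : HasSupNorm v α)
    (hf : ∀ y, 0 < y → 0 < f y) (hF : ∀ y, 0 < y → HasDerivAt F (f y) y) :
    energy v = 4 * (timeMap F α * action F α) := by
  obtain ⟨x₀, hx₀, rfl, h0⟩ := h.exists_max hv
  have hl : Ioo 0 x₀ ⊆ Ioo (0 : ℝ) 1 := Ioo_subset_Ioo_right hx₀.2.le
  have hr : Ioo x₀ 1 ⊆ Ioo (0 : ℝ) 1 := Ioo_subset_Ioo_left hx₀.1.le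
  obtain ⟨htl, hal⟩ := timeMap_action_of_bijOn h.mu_pos hx₀.1.le
    (fun x hx => h.hasDerivAt (hl hx)) (h.bijOn_left hf hx₀ h0)
    (fun x hx => h.sq_deriv hF hx₀ h0 (hl hx)) fun x hx => (h.deriv_pos hf hx₀ h0 hx).ne'
  obtain ⟨htr, har⟩ := timeMap_action_of_bijOn h.mu_pos hx₀.2.le
    (fun x hx => h.hasDerivAt (hr hx)) (h.bijOn_right hf hx₀ h0)
    (fun x hx => h.sq_deriv hF hx₀ h0 (hr hx)) fun x hx => (h.deriv_neg hf hx₀ h0 hx).ne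
  have hint : ∀ a b, a ≤ b → Ioo a b ⊆ Ioo (0 : ℝ) 1 →
      IntervalIntegrable (fun x => deriv v x ^ 2) volume a b := fun a b hab hsub =>
    (intervalIntegrable_iff_integrableOn_Ioo_of_le hab).2 (h.integrableOn_sq_deriv.mono_set hsub)
  have htime : √(2 * μ) = 2 * timeMap F (v x₀) := by linarith
  rw [energy, ← intervalIntegral.integral_add_adjacent_intervals (hint 0 x₀ hx₀.1.le hl)
    (hint x₀ 1 hx₀.2.le hr), hal, har, htime]
  ring

end IsPositiveSolution

/-! ### Existence by shooting -/

theorem exists_integralCurve_of_forall_Ioo {E : Type*} [NormedAddCommGroup E] [NormedSpace ℝ E]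
    {V : E → E} {K : NNReal} (hV : LipschitzWith K V) {x₀ : E}
    (h : ∀ T > 0, ∃ γ : ℝ → E, γ 0 = x₀ ∧ ∀ t ∈ Ioo (-T) T, HasDerivAt γ (V (γ t)) t) :
    ∃ γ : ℝ → E, γ 0 = x₀ ∧ ∀ t, HasDerivAt γ (V (γ t)) t := by
  choose! γ hγ0 hγ using h
  have heq : ∀ S T, 0 < S → S ≤ T → EqOn (γ S) (γ T) (Ioo (-S) S) := fun S T hS hST =>
    ODE_solution_unique_of_mem_Ioo (v := fun _ => V) (s := fun _ => univ) (t₀ := 0)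
      (fun t _ => hV.lipschitzOnWith) ⟨neg_lt_zero.2 hS, hS⟩
      (fun t ht => ⟨hγ S hS t ht, mem_univ _⟩)
      (fun t ht => ⟨hγ T (hS.trans_le hST) t
        (Ioo_subset_Ioo (neg_le_neg hST) hST ht), mem_univ _⟩)
      (by rw [hγ0 S hS, hγ0 T (hS.trans_le hST)])
  have mem_Ioo : ∀ t c : ℝ, 0 < c → t ∈ Ioo (-(|t| + c)) (|t| + c) := fun t c hc =>
    abs_lt.1 (lt_add_of_pos_right _ hc)
  refine ⟨fun t => γ (|t| + 1) t, by simpa using hγ0 1 one_pos, fun t => ?_⟩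
  have hloc : (fun s => γ (|s| + 1) s) =ᶠ[𝓝 t] γ (|t| + 2) := by
    have hlt : ∀ᶠ s in 𝓝 t, |s| < |t| + 1 :=
      continuous_abs.continuousAt.eventually_lt continuousAt_const (lt_add_one _)
    filter_upwards [hlt] with s hs
    exact heq (|s| + 1) (|t| + 2) (by positivity) (by linarith) (mem_Ioo s 1 one_pos)
  have hd := hγ (|t| + 2) (by positivity) t (mem_Ioo t 2 two_pos)
  rw [← hloc.eq_of_nhds] at hd
  exact hd.congr_of_eventuallyEq hloc

/-- In the variables `(w, T w')` the a priori bounds needed by the Picard–Lindelöf theorem hold on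
all of `(-T, T)`. -/
theorem exists_second_order_solution_Ioo {φ : ℝ → ℝ} {K : NNReal} (hK : LipschitzWith K φ)
    {M T : ℝ} (hT : 0 < T) (hM : ∀ u, |φ u| ≤ M) (α : ℝ) :
    ∃ γ : ℝ → ℝ × ℝ, γ 0 = (α, 0) ∧
      ∀ t ∈ Ioo (-T) T, HasDerivAt γ ((γ t).2, -φ (γ t).1) t := by
  have hM0 : 0 ≤ M := (abs_nonneg _).trans (hM 0)
  set V : ℝ → ℝ × ℝ → ℝ × ℝ := fun _ q => (T⁻¹ * q.2, -T * φ q.1) with hV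
  have hlip : LipschitzWith (max (‖T⁻¹‖₊ * 1) (‖-T‖₊ * (K * 1))) (V 0) :=
    ((lipschitzWith_smul T⁻¹).comp LipschitzWith.prod_snd).prodMk
      ((lipschitzWith_smul (-T)).comp (hK.comp LipschitzWith.prod_fst))
  have hmem : (0 : ℝ) ∈ Icc (-T) T := ⟨by linarith, hT.le⟩
  lift M to NNReal using hM0
  lift T to NNReal using hT.le
  have hbound : ∀ q ∈ Metric.closedBall ((α, 0) : ℝ × ℝ) (M * T ^ 2 : NNReal),
      ‖V 0 q‖ ≤ (M * T : NNReal) := by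
    intro q hq
    rw [Metric.mem_closedBall, Prod.dist_eq, max_le_iff] at hq
    have h2 : |q.2| ≤ M * T ^ 2 := by simpa using hq.2
    simp only [hV, Prod.norm_def, norm_mul, norm_inv, norm_neg, Real.norm_eq_abs, abs_of_pos hT,
      NNReal.coe_mul]
    refine max_le ?_ ?_
    · rw [inv_mul_le_iff₀ hT]
      linarith
    · rw [mul_comm]
      exact mul_le_mul_of_nonneg_right (hM _) hT.le
  have hPL : IsPicardLindelof V (⟨0, hmem⟩ : Icc (-T : ℝ) T) (α, 0) (M * T ^ 2) 0 (M * T)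
      (max (‖(T : ℝ)⁻¹‖₊ * 1) (‖-(T : ℝ)‖₊ * (K * 1))) := by
    refine ⟨fun t _ => hlip.lipschitzOnWith, fun x _ => continuousOn_const, fun _ _ => hbound, ?_⟩
    simp only [sub_zero, zero_sub, neg_neg, max_self, NNReal.coe_zero, NNReal.coe_mul,
      NNReal.coe_pow]
    apply le_of_eq
    ring
  obtain ⟨γ, hγ0, hγ⟩ := hPL.exists_eq_forall_mem_Icc_hasDerivWithinAt₀
  have hγ0 : γ 0 = (α, 0) := hγ0
  refine ⟨fun t => ((γ t).1, (T : ℝ)⁻¹ * (γ t).2), by simp [hγ0], fun t ht => ?_⟩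
  have hd : HasDerivAt γ (V t (γ t)) t :=
    (hγ t (Ioo_subset_Icc_self ht)).hasDerivAt (Icc_mem_nhds ht.1 ht.2)
  have hsnd : HasDerivAt (fun t => (γ t).2) (-T * φ (γ t).1) t := hd.snd
  refine hd.fst.prodMk ((hsnd.const_mul (T : ℝ)⁻¹).congr_deriv ?_)
  field_simp

theorem exists_second_order_solution {φ : ℝ → ℝ} {K : NNReal} (hK : LipschitzWith K φ) {M : ℝ}
    (hM : ∀ u, |φ u| ≤ M) (α : ℝ) :
    ∃ w z : ℝ → ℝ, w 0 = α ∧ z 0 = 0 ∧ (∀ t, HasDerivAt w (z t) t) ∧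
      ∀ t, HasDerivAt z (-φ (w t)) t := by
  have hlip : LipschitzWith (max 1 (K * 1)) fun q : ℝ × ℝ => (q.2, -φ q.1) :=
    LipschitzWith.prod_snd.prodMk (hK.comp LipschitzWith.prod_fst).neg
  obtain ⟨γ, hγ0, hγ⟩ := exists_integralCurve_of_forall_Ioo hlip
    fun T hT => exists_second_order_solution_Ioo hK hT hM α
  exact ⟨fun t => (γ t).1, fun t => (γ t).2, by simp [hγ0], by simp [hγ0], fun t => (hγ t).fst,
    fun t => (hγ t).snd⟩

theorem exists_first_zero {w : ℝ → ℝ} (hw : Continuous w) (h0 : 0 < w 0) {T : ℝ} (hT : 0 ≤ T)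
    (hwT : w T ≤ 0) : ∃ τ > 0, w τ = 0 ∧ ∀ s ∈ Ico 0 τ, 0 < w s := by
  have hzero : ∀ s, 0 ≤ s → w s ≤ 0 → ∃ t ∈ Icc 0 s, w t = 0 := fun s hs hws =>
    intermediate_value_Icc' hs hw.continuousOn ⟨hws, h0.le⟩
  obtain ⟨t, ht, hwt⟩ := hzero T hT hwT
  have hcomp : IsCompact (Icc 0 T ∩ w ⁻¹' {0}) :=
    isCompact_Icc.inter_right (isClosed_singleton.preimage hw)
  obtain ⟨τ, ⟨hτ, hτ0⟩, hmin⟩ := hcomp.exists_isLeast ⟨t, ht, hwt⟩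
  refine ⟨τ, hτ.1.lt_of_ne ?_, hτ0, fun s hs => ?_⟩
  · rintro rfl
    exact h0.ne' hτ0
  · by_contra! hneg
    obtain ⟨r, hr, hwr⟩ := hzero s hs.1 hneg
    exact ((hmin ⟨⟨hr.1, hr.2.trans (hs.2.le.trans hτ.2)⟩, hwr⟩).trans hr.2).not_gt hs.2

/-- By concavity `w` lies below a line of negative slope, so it must reach `0`. -/
theorem exists_first_zero_of_second_order {φ w z : ℝ → ℝ} (hφ : ∀ u, 0 ≤ φ u) (h0 : 0 < w 0)
    (hφ0 : 0 < φ (w 0)) (hz0 : z 0 = 0) (hw : ∀ t, HasDerivAt w (z t) t)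
    (hz : ∀ t, HasDerivAt z (-φ (w t)) t) :
    ∃ τ > 0, w τ = 0 ∧ ∀ s ∈ Ico 0 τ, 0 < w s ∧ w s ≤ w 0 := by
  have hz_anti : Antitone z := antitone_of_hasDerivAt_nonpos hz fun t => neg_nonpos.2 (hφ _)
  have hz_nonpos : ∀ t, 0 ≤ t → z t ≤ 0 := fun t ht => hz0 ▸ hz_anti ht
  have hw_anti : AntitoneOn w (Ici 0) := antitoneOn_of_hasDerivWithinAt_nonpos (convex_Ici 0)
    (fun t _ => (hw t).continuousAt.continuousWithinAt) (fun t _ => (hw t).hasDerivWithinAt)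
    fun t ht => hz_nonpos t (interior_subset ht)
  obtain ⟨t₁, ht₁, hzt₁⟩ : ∃ t₁, 0 ≤ t₁ ∧ z t₁ < 0 := by
    by_contra! hnonneg
    have hzero : HasDerivWithinAt z 0 (Ici 0) 0 :=
      (hasDerivWithinAt_const (0 : ℝ) (Ici 0) (0 : ℝ)).congr
        (fun t ht => (hz_nonpos t ht).antisymm (hnonneg t ht)) hz0
    have := (uniqueDiffOn_Ici (0 : ℝ) 0 self_mem_Ici).eq_deriv _ hzero (hz 0).hasDerivWithinAt
    linarith
  have hline : AntitoneOn (fun t => w t - z t₁ * t) (Ici t₁) := by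
    have hd : ∀ t, HasDerivAt (fun t => w t - z t₁ * t) (z t - z t₁) t := fun t => by
      simpa using! (hw t).sub ((hasDerivAt_id t).const_mul (z t₁))
    exact antitoneOn_of_hasDerivWithinAt_nonpos (convex_Ici t₁)
      (fun t _ => (hd t).continuousAt.continuousWithinAt) (fun t _ => (hd t).hasDerivWithinAt)
      fun t ht => sub_nonpos.2 (hz_anti (interior_subset ht : t ∈ Ici t₁))
  set T := t₁ + w 0 / -z t₁ with hT
  have htT : t₁ ≤ T := le_add_of_nonneg_right (div_nonneg h0.le (neg_nonneg.2 hzt₁.le))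
  have hwT : w T ≤ 0 := by
    have hwTt : w T - z t₁ * T ≤ w t₁ - z t₁ * t₁ := hline self_mem_Ici htT htT
    have hwt : w t₁ ≤ w 0 := hw_anti self_mem_Ici ht₁ ht₁
    have hprod : z t₁ * (T - t₁) = -w 0 := by rw [hT]; field_simp [hzt₁.ne]; ring
    linarith
  obtain ⟨τ, hτ, hwτ, hpos⟩ := exists_first_zero
    (continuous_iff_continuousAt.2 fun t => (hw t).continuousAt) h0 (ht₁.trans htT) hwT
  exact ⟨τ, hτ, hwτ, fun s hs => ⟨hpos s hs, hw_anti self_mem_Ici hs.1 hs.1⟩⟩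

theorem isPositiveSolution_rescale {f φ w z : ℝ → ℝ} {a b : ℝ} (hab : -a < b) (hφ : Continuous φ)
    (hw : ∀ t, HasDerivAt w (z t) t) (hz : ∀ t, HasDerivAt z (-φ (w t)) t) (ha : w (-a) = 0)
    (hb : w b = 0) (hpos : ∀ t ∈ Ioo (-a) b, 0 < w t) (hφf : ∀ t ∈ Ioo (-a) b, φ (w t) = f (w t)) :
    IsPositiveSolution f ((a + b) ^ 2) fun x => w (-a + (a + b) * x) := by
  have hℓ : 0 < a + b := by linarith
  have hwd : deriv w = z := funext fun t => (hw t).deriv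
  have hzd : deriv z = fun t => -φ (w t) := funext fun t => (hz t).deriv
  have hwC : Continuous w := continuous_iff_continuousAt.2 fun t => (hw t).continuousAt
  have hz1 : ContDiff ℝ 1 z := by
    rw [contDiff_one_iff_deriv, hzd]
    exact ⟨fun t => (hz t).differentiableAt, (hφ.comp hwC).neg⟩
  have hw2 : ContDiff ℝ 2 w := by
    rw [← one_add_one_eq_two, contDiff_succ_iff_deriv, hwd]
    exact ⟨fun t => (hw t).differentiableAt, by simp, hz1⟩
  have haff : ∀ x : ℝ, HasDerivAt (fun x => -a + (a + b) * x) (a + b) x := fun x => by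
    simpa using ((hasDerivAt_id x).const_mul (a + b)).const_add (-a)
  have hmap : ∀ x ∈ Ioo (0 : ℝ) 1, -a + (a + b) * x ∈ Ioo (-a) b := fun x hx => by
    constructor <;> nlinarith [hx.1, hx.2]
  refine ⟨by positivity, (hw2.comp (by fun_prop)).contDiffOn, fun x hx => ?_,
    fun x hx => hpos _ (hmap x hx), by simpa using ha, by simpa using hb⟩
  have hv1 : deriv (fun x => w (-a + (a + b) * x)) = fun x => z (-a + (a + b) * x) * (a + b) :=
    funext fun x => ((hw _).comp x (haff x)).deriv
  have hv2 := (((hz _).comp x (haff x)).mul_const (a + b)).deriv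
  simp only [Function.comp_def] at hv2
  rw [hv1, hv2, hφf _ (hmap x hx)]
  ring

theorem exists_isPositiveSolution {f : ℝ → ℝ} {α : ℝ} {K : NNReal} (hα : 0 < α)
    (hlip : LipschitzOnWith K f (Icc 0 α)) (hf : ∀ y ∈ Icc 0 α, 0 ≤ f y) (hfα : 0 < f α) :
    ∃ (μ : ℝ) (v : ℝ → ℝ), IsPositiveSolution f μ v ∧ HasSupNorm v α := by
  set φ : ℝ → ℝ := fun u => f (projIcc 0 α hα.le u)
  have hφ_lip : LipschitzWith (K * 1) φ := hlip.to_restrict.comp (LipschitzWith.projIcc hα.le)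
  have hφ_eq : ∀ u ∈ Icc 0 α, φ u = f u := fun u hu => by simp only [φ, projIcc_of_mem hα.le hu]
  have hφ_nonneg : ∀ u, 0 ≤ φ u := fun u => hf _ (Subtype.coe_prop _)
  obtain ⟨M, hM⟩ := isCompact_Icc.exists_bound_of_continuousOn hlip.continuousOn
  obtain ⟨w, z, hw0, hz0, hw, hz⟩ := exists_second_order_solution hφ_lip (M := M)
    (fun u => hM _ (Subtype.coe_prop _)) α
  have hφα : 0 < φ (w 0) := by rwa [hw0, hφ_eq α ⟨hα.le, le_rfl⟩]
  obtain ⟨b, hb, hwb, hposb⟩ := exists_first_zero_of_second_order hφ_nonneg (hw0 ▸ hα) hφα hz0 hw hz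
  obtain ⟨a, ha, hwa, hposa⟩ := exists_first_zero_of_second_order (w := fun t => w (-t))
    (z := fun t => -z (-t)) hφ_nonneg (by simpa [hw0]) (by simpa using hφα) (by simp [hz0])
    (fun t => by simpa [Function.comp_def] using! (hw _).comp t (hasDerivAt_neg t))
    (fun t => by simpa [Function.comp_def] using! ((hz _).comp t (hasDerivAt_neg t)).neg)
  have hrange : ∀ t ∈ Ioo (-a) b, 0 < w t ∧ w t ≤ α := fun t ht => by
    rcases le_total 0 t with h | h
    · exact hw0 ▸ hposb t ⟨h, ht.2⟩
    · simpa [hw0] using hposa (-t) ⟨by linarith, by linarith [ht.1]⟩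
  have hsol : IsPositiveSolution f ((a + b) ^ 2) fun x => w (-a + (a + b) * x) :=
    isPositiveSolution_rescale (by linarith) hφ_lip.continuous hw hz hwa hwb
      (fun t ht => (hrange t ht).1) fun t ht => hφ_eq _ ⟨(hrange t ht).1.le, (hrange t ht).2⟩
  have hℓ : 0 < a + b := by linarith
  refine ⟨_, _, hsol, IsGreatest.isLUB ⟨⟨a / (a + b), ⟨by positivity,
    (div_le_one hℓ).2 (by linarith)⟩, ?_⟩, ?_⟩⟩
  · simp only [mul_div_cancel₀ a hℓ.ne', neg_add_cancel, hw0, abs_of_pos hα]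
  · rintro _ ⟨x, hx, rfl⟩
    simp only [abs_of_nonneg (hsol.nonneg hx)]
    rcases hx.1.eq_or_lt with rfl | h0
    · exact hsol.left.trans_le hα.le
    rcases hx.2.eq_or_lt with rfl | h1
    · exact hsol.right.trans_le hα.le
    exact (hrange _ ⟨by nlinarith, by nlinarith⟩).2

variable {p s : ℝ}

/-! ### The coefficients as integrals against one measure -/

/-- The rescaled leading potential difference `1 - s ^ (p + 1)`. -/
noncomputable def gap (p s : ℝ) : ℝ := 1 - s ^ (p + 1)

/-- The density `1 / √(1 - s ^ (p + 1))`, singular at `s = 1`. -/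
noncomputable def weight (p s : ℝ) : ℝ := 1 / √(gap p s)

/-- The measure `ds / √(1 - s ^ (p + 1))` on `(0, 1)`, for `p = 1` the law of `sin θ` for `θ`
uniform on `(0, π/2)`, up to normalisation. All coefficients of the expansion are integrals against
it. -/
noncomputable def arcsineMeasure (p : ℝ) : Measure ℝ :=
  (volume.restrict (Ioo 0 1)).withDensity fun s => ENNReal.ofReal (weight p s)


theorem weight_nonneg (p s : ℝ) : 0 ≤ weight p s := by
  unfold weight
  positivity

theorem gap_le_one (hs : 0 ≤ s) : gap p s ≤ 1 :=
  sub_le_self _ (Real.rpow_nonneg hs _)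

theorem one_sub_le_gap (hp : 0 ≤ p) (hs : s ∈ Ioo (0 : ℝ) 1) : 1 - s ≤ gap p s := by
  have : s ^ (p + 1) ≤ s ^ (1 : ℝ) :=
    Real.rpow_le_rpow_of_exponent_ge hs.1 hs.2.le (by linarith)
  rw [Real.rpow_one] at this
  exact sub_le_sub_left this 1

theorem one_sub_sq_le_two_mul_gap (hp : 0 ≤ p) (hs : s ∈ Ioo (0 : ℝ) 1) :
    1 - s ^ 2 ≤ 2 * gap p s := by
  nlinarith [one_sub_le_gap hp hs, sq_nonneg (1 - s)]

theorem gap_pos (hp : 0 ≤ p) (hs : s ∈ Ioo (0 : ℝ) 1) : 0 < gap p s :=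
  (sub_pos.2 hs.2).trans_le (one_sub_le_gap hp hs)

theorem continuous_gap (hp : 0 ≤ p) : Continuous (gap p) :=
  continuous_const.sub (Real.continuous_rpow_const (by linarith))

theorem measurable_weight (p : ℝ) : Measurable (weight p) :=
  ((measurable_const.sub (measurable_id.pow_const (p + 1))).sqrt).const_div 1

theorem gap_mul_weight (p s : ℝ) : gap p s * weight p s = √(gap p s) := by
  rw [weight, mul_one_div, Real.div_sqrt]

theorem div_gap_rpow_three_halves (hp : 0 ≤ p) (hs : s ∈ Ioo (0 : ℝ) 1) (x : ℝ) :
    x / gap p s ^ (3 / 2 : ℝ) = x / gap p s * weight p s := by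
  rw [show (3 / 2 : ℝ) = 1 + 1 / 2 by norm_num, Real.rpow_add (gap_pos hp hs), Real.rpow_one,
    ← Real.sqrt_eq_rpow, weight, div_mul_div_comm, mul_one]

theorem div_gap_rpow_five_halves (hp : 0 ≤ p) (hs : s ∈ Ioo (0 : ℝ) 1) (x : ℝ) :
    x / gap p s ^ (5 / 2 : ℝ) = x / gap p s ^ 2 * weight p s := by
  rw [show (5 / 2 : ℝ) = 2 + 1 / 2 by norm_num, Real.rpow_add (gap_pos hp hs), Real.rpow_two,
    ← Real.sqrt_eq_rpow, weight, div_mul_div_comm, mul_one]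

theorem integrableOn_one_sub_rpow {r : ℝ} (hr : -1 < r) :
    IntegrableOn (fun s : ℝ => (1 - s) ^ r) (Ioo 0 1) := by
  have h := (intervalIntegral.intervalIntegrable_rpow' (a := 0) (b := 1) hr).comp_sub_left 1
  simp only [sub_zero, sub_self] at h
  exact (intervalIntegrable_iff_integrableOn_Ioo_of_le zero_le_one).1 h.symm

theorem weight_le (hp : 0 ≤ p) (hs : s ∈ Ioo (0 : ℝ) 1) :
    weight p s ≤ (1 - s) ^ (-(1 / 2) : ℝ) := by
  rw [Real.rpow_neg (sub_pos.2 hs.2).le, ← Real.sqrt_eq_rpow, weight, one_div]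
  exact inv_anti₀ (Real.sqrt_pos.2 (sub_pos.2 hs.2)) (Real.sqrt_le_sqrt (one_sub_le_gap hp hs))

theorem integrableOn_weight (hp : 0 ≤ p) : IntegrableOn (weight p) (Ioo 0 1) := by
  refine (integrableOn_one_sub_rpow (r := -(1 / 2)) (by norm_num)).mono'
    (measurable_weight p).aestronglyMeasurable ?_
  refine ae_restrict_of_forall_mem measurableSet_Ioo fun s hs => ?_
  rw [Real.norm_of_nonneg (weight_nonneg p s)]
  exact weight_le hp hs

theorem isFiniteMeasure_arcsineMeasure (hp : 0 ≤ p) : IsFiniteMeasure (arcsineMeasure p) :=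
  isFiniteMeasure_withDensity_ofReal (integrableOn_weight hp).2

theorem arcsineMeasure_absolutelyContinuous (p : ℝ) :
    arcsineMeasure p ≪ volume.restrict (Ioo 0 1) :=
  withDensity_absolutelyContinuous _ _

theorem ae_arcsineMeasure_of_forall_mem_Ioo {P : ℝ → Prop} (h : ∀ s ∈ Ioo (0 : ℝ) 1, P s) :
    ∀ᵐ s ∂arcsineMeasure p, P s :=
  (arcsineMeasure_absolutelyContinuous p).ae_le (ae_restrict_of_forall_mem measurableSet_Ioo h)

theorem integral_arcsineMeasure (p : ℝ) (b : ℝ → ℝ) :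
    ∫ s, b s ∂arcsineMeasure p = ∫ s in Ioo (0 : ℝ) 1, b s * weight p s := by
  rw [arcsineMeasure, integral_withDensity_eq_integral_toReal_smul
    (measurable_weight p).ennreal_ofReal (ae_of_all _ fun _ => ENNReal.ofReal_lt_top)]
  simp only [ENNReal.toReal_ofReal (weight_nonneg p _), smul_eq_mul, mul_comm]

theorem integral_arcsineMeasure_congr {b b' : ℝ → ℝ} (h : ∀ s ∈ Ioo (0 : ℝ) 1, b s = b' s) :
    ∫ s, b s ∂arcsineMeasure p = ∫ s, b' s ∂arcsineMeasure p :=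
  integral_congr_ae (ae_arcsineMeasure_of_forall_mem_Ioo h)

theorem aestronglyMeasurable_arcsineMeasure {b : ℝ → ℝ} (hb : ContinuousOn b (Ioo 0 1)) :
    AEStronglyMeasurable b (arcsineMeasure p) :=
  (hb.aestronglyMeasurable measurableSet_Ioo).mono_ac (arcsineMeasure_absolutelyContinuous p)

theorem integrable_arcsineMeasure (hp : 0 ≤ p) {b : ℝ → ℝ} (hb : ContinuousOn b (Ioo 0 1)) {C : ℝ}
    (hC : ∀ s ∈ Ioo (0 : ℝ) 1, |b s| ≤ C) : Integrable b (arcsineMeasure p) :=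
  have := isFiniteMeasure_arcsineMeasure hp
  .of_bound (aestronglyMeasurable_arcsineMeasure hb) C (ae_arcsineMeasure_of_forall_mem_Ioo hC)

theorem intervalIntegral_zero_one_eq_setIntegral_Ioo (f : ℝ → ℝ) :
    ∫ s in (0 : ℝ)..1, f s = ∫ s in Ioo (0 : ℝ) 1, f s := by
  rw [intervalIntegral.integral_of_le zero_le_one, integral_Ioc_eq_integral_Ioo]

theorem C0_eq (p : ℝ) : C0 p = (arcsineMeasure p).real univ := by
  have h := integral_arcsineMeasure p fun _ => 1
  simp only [integral_const, smul_eq_mul, mul_one, one_mul] at h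
  rw [h, C0, intervalIntegral_zero_one_eq_setIntegral_Ioo]
  rfl

theorem abs_integral_arcsineMeasure_le (hp : 0 ≤ p) {b : ℝ → ℝ} {C : ℝ}
    (hC : ∀ s ∈ Ioo (0 : ℝ) 1, |b s| ≤ C) : |∫ s, b s ∂arcsineMeasure p| ≤ C * C0 p := by
  have := isFiniteMeasure_arcsineMeasure hp
  rw [C0_eq]
  exact norm_integral_le_of_norm_le_const (f := b) (ae_arcsineMeasure_of_forall_mem_Ioo hC)

theorem bijOn_sin_rpow {r : ℝ} (hr : 0 < r) :
    BijOn (fun θ => Real.sin θ ^ r) (Ioo 0 (Real.pi / 2)) (Ioo 0 1) := by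
  have hcont : ContinuousOn (fun θ => Real.sin θ ^ r) (Icc 0 (Real.pi / 2)) :=
    Real.continuous_sin.continuousOn.rpow_const fun _ _ => Or.inr hr.le
  have hmono : StrictMonoOn (fun θ => Real.sin θ ^ r) (Icc 0 (Real.pi / 2)) := fun x hx y hy hxy =>
    Real.rpow_lt_rpow (Real.sin_nonneg_of_nonneg_of_le_pi hx.1 (by linarith [hx.2, Real.pi_pos]))
      (Real.strictMonoOn_sin ⟨by linarith [hx.1, Real.pi_pos], hx.2⟩
        ⟨by linarith [hy.1, Real.pi_pos], hy.2⟩ hxy) hr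
  have := (hmono.injOn.mono Ioo_subset_Icc_self).bijOn_image
  rwa [hcont.image_Ioo_of_strictMonoOn Real.pi_div_two_pos.le hmono, Real.sin_zero,
    Real.sin_pi_div_two, Real.one_rpow, Real.zero_rpow hr.ne'] at this

/-- The change of variables `s = sin θ ^ (2 / (p + 1))`. -/
theorem integral_comp_sin_rpow (hp : -1 < p) (b : ℝ → ℝ) :
    ∫ θ in (0 : ℝ)..(Real.pi / 2),
      b (Real.sin θ ^ (2 / (p + 1))) * Real.sin θ ^ ((1 - p) / (p + 1)) =
    (p + 1) / 2 * ∫ s, b s ∂arcsineMeasure p := by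
  have hp1 : 0 < p + 1 := by linarith
  have hbij := bijOn_sin_rpow (r := 2 / (p + 1)) (by positivity)
  have hsin : ∀ θ ∈ Ioo 0 (Real.pi / 2), 0 < Real.sin θ := fun θ hθ =>
    Real.sin_pos_of_pos_of_lt_pi hθ.1 (by linarith [hθ.2, Real.pi_pos])
  have hderiv : ∀ θ ∈ Ioo 0 (Real.pi / 2),
      HasDerivWithinAt (fun θ => Real.sin θ ^ (2 / (p + 1)))
        (Real.cos θ * (2 / (p + 1)) * Real.sin θ ^ (2 / (p + 1) - 1)) (Ioo 0 (Real.pi / 2)) θ :=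
    fun θ hθ => ((Real.hasDerivAt_sin θ).rpow_const (Or.inl (hsin θ hθ).ne')).hasDerivWithinAt
  rw [integral_arcsineMeasure, ← hbij.image_eq,
    integral_image_eq_integral_abs_deriv_smul measurableSet_Ioo hderiv hbij.injOn,
    ← integral_const_mul, intervalIntegral.integral_of_le Real.pi_div_two_pos.le,
    integral_Ioc_eq_integral_Ioo]
  refine setIntegral_congr_fun measurableSet_Ioo fun θ hθ => ?_
  have h0 := hsin θ hθ
  have hcos : 0 < Real.cos θ := Real.cos_pos_of_mem_Ioo ⟨by linarith [hθ.1, hθ.2], hθ.2⟩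
  have hgap : gap p (Real.sin θ ^ (2 / (p + 1))) = Real.cos θ ^ 2 := by
    rw [gap, ← Real.rpow_mul h0.le, div_mul_cancel₀ _ hp1.ne', Real.rpow_two, ← Real.cos_sq']
  simp only [smul_eq_mul, weight, hgap]
  rw [abs_of_pos (by positivity), Real.sqrt_sq hcos.le,
    show (1 - p) / (p + 1) = 2 / (p + 1) - 1 by field_simp; ring]
  field_simp

theorem integral_comp_sin_rpow_mul_self (hp : -1 < p) (b : ℝ → ℝ) :
    ∫ θ in (0 : ℝ)..(Real.pi / 2),
      b (Real.sin θ ^ (2 / (p + 1))) * Real.sin θ ^ ((3 - p) / (p + 1)) =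
    (p + 1) / 2 * ∫ s, s * b s ∂arcsineMeasure p := by
  have hp1 : p + 1 ≠ 0 := by linarith
  rw [← integral_comp_sin_rpow hp, intervalIntegral.integral_of_le Real.pi_div_two_pos.le,
    intervalIntegral.integral_of_le Real.pi_div_two_pos.le]
  refine setIntegral_congr_fun measurableSet_Ioc fun θ hθ => ?_
  have h0 := Real.sin_pos_of_pos_of_lt_pi hθ.1 (by linarith [hθ.2, Real.pi_pos])
  rw [show (3 - p) / (p + 1) = 2 / (p + 1) + (1 - p) / (p + 1) by field_simp; ring,
    Real.rpow_add h0]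
  ring

theorem integral_div_gap_rpow_three_halves (hp : 0 ≤ p) (b : ℝ → ℝ) :
    ∫ s in (0 : ℝ)..1, b s / (1 - s ^ (p + 1)) ^ (3 / 2 : ℝ) =
      ∫ s, b s / gap p s ∂arcsineMeasure p := by
  rw [intervalIntegral_zero_one_eq_setIntegral_Ioo, integral_arcsineMeasure]
  exact setIntegral_congr_fun measurableSet_Ioo fun s hs => div_gap_rpow_three_halves hp hs _

theorem C1_eq (hp : 0 ≤ p) :
    C1 p = -((p + 1) / 8) * ∫ s, (1 - s ^ 2) / gap p s ∂arcsineMeasure p := by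
  rw [C1, integral_div_gap_rpow_three_halves hp]

theorem C2_eq (hp : 0 ≤ p) :
    C2 p = 3 * (p + 1) ^ 2 / 128 * ∫ s, ((1 - s ^ 2) / gap p s) ^ 2 ∂arcsineMeasure p := by
  rw [C2, intervalIntegral_zero_one_eq_setIntegral_Ioo, integral_arcsineMeasure]
  congr 1
  refine setIntegral_congr_fun measurableSet_Ioo fun s hs => ?_
  simp only [div_pow]
  exact div_gap_rpow_five_halves hp hs _

theorem E0_eq (p : ℝ) : E0 p = ∫ s, gap p s ∂arcsineMeasure p := by
  rw [E0, intervalIntegral_zero_one_eq_setIntegral_Ioo, integral_arcsineMeasure]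
  simp only [gap_mul_weight]
  rfl

theorem E1_eq (p : ℝ) : E1 p = (p + 1) / 8 * ∫ s, (1 - s ^ 2) ∂arcsineMeasure p := by
  rw [E1, intervalIntegral_zero_one_eq_setIntegral_Ioo, integral_arcsineMeasure]
  simp only [weight, mul_one_div]
  rfl

theorem E4_eq (hp : 0 ≤ p) :
    E4 p = -((p + 1) ^ 2 / 128) *
      ∫ s, ((1 - s ^ 2) / gap p s) ^ 2 * gap p s ∂arcsineMeasure p := by
  rw [E4, integral_div_gap_rpow_three_halves hp]
  congr 1
  refine integral_arcsineMeasure_congr fun s hs => ?_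
  have := (gap_pos hp hs).ne'
  field_simp

theorem C11_eq (hp : -1 < p) (α : ℝ) :
    C11 p α = ∫ s, s * Real.cos (2 * α * s) ∂arcsineMeasure p := by
  have hp1 : p + 1 ≠ 0 := by linarith
  rw [C11, integral_comp_sin_rpow_mul_self hp fun s => Real.cos (2 * α * s), ← mul_assoc,
    div_mul_div_cancel₀ hp1, div_self two_ne_zero, one_mul]

theorem C12_eq (hp : 0 ≤ p) (α : ℝ) :
    C12 p α = (p - 1) / 4 * (∫ s, (Real.sin (2 * α) - Real.sin (2 * α * s)) ∂arcsineMeasure p)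
      + (p + 1) / 4 * ∫ s, (1 - s) * Real.sin (2 * α * s) / gap p s ∂arcsineMeasure p := by
  have hp1 : p + 1 ≠ 0 := by linarith
  simp only [C12, div_mul_eq_mul_div (1 - _ : ℝ)]
  rw [integral_comp_sin_rpow (by linarith) fun s => Real.sin (2 * α) - Real.sin (2 * α * s),
    integral_div_gap_rpow_three_halves hp]
  field_simp
  ring

theorem C21_eq (hp : -1 < p) (α : ℝ) :
    C21 p α = -(1 / 2) * ∫ s, s * Real.sin (2 * α * s) ∂arcsineMeasure p := by
  have hp1 : p + 1 ≠ 0 := by linarith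
  rw [C21, integral_comp_sin_rpow_mul_self hp fun s => Real.sin (2 * α * s), ← mul_assoc]
  congr 1
  field_simp

theorem E2_eq (hp : -1 < p) (α : ℝ) :
    E2 p α = -((p + 1) / 8) *
      ∫ s, (Real.sin (2 * α) - s * Real.sin (2 * α * s)) ∂arcsineMeasure p := by
  rw [E2, integral_comp_sin_rpow hp fun s => Real.sin (2 * α) - s * Real.sin (2 * α * s)]
  ring

/-! ### The oscillating term -/

theorem hasDerivAt_gap (hs : 0 < s) : HasDerivAt (gap p) (-((p + 1) * s ^ p)) s := by
  have h := (Real.hasDerivAt_rpow_const (p := p + 1) (Or.inl hs.ne')).const_sub 1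
  rwa [add_sub_cancel_right] at h

theorem mul_rpow_self (hs : 0 < s) : s * s ^ p = 1 - gap p s := by
  rw [gap, sub_sub_cancel, Real.rpow_add_one hs.ne', mul_comm]

theorem hasDerivAt_weight (hp : 0 ≤ p) (hs : s ∈ Ioo (0 : ℝ) 1) :
    HasDerivAt (weight p) ((p + 1) / 2 * s ^ p / gap p s * weight p s) s := by
  have hg := gap_pos hp hs
  have hroot := (Real.sqrt_pos.2 hg).ne'
  have h := ((hasDerivAt_gap (p := p) hs.1).sqrt hg.ne').inv hroot
  have hweight : weight p = (fun y => √(gap p y))⁻¹ := by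
    ext y
    simp only [weight, one_div, Pi.inv_apply]
  rw [hweight]
  refine h.congr_deriv ?_
  rw [Real.sq_sqrt hg.le, Pi.inv_apply]
  field_simp

theorem setIntegral_Ioo_deriv_eq_zero {f f' : ℝ → ℝ} {C : ℝ} (hp : 0 ≤ p)
    (hf : ∀ s ∈ Ioo (0 : ℝ) 1, HasDerivAt f (f' s) s) (hint : IntegrableOn f' (Ioo 0 1))
    (hle : ∀ s ∈ Ioo (0 : ℝ) 1, |f s| ≤ C * (s * √(gap p s))) :
    ∫ s in Ioo (0 : ℝ) 1, f' s = 0 := by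
  have hcont : Continuous fun s => C * (s * √(gap p s)) :=
    continuous_const.mul (continuous_id.mul (continuous_gap hp).sqrt)
  have h0 : Tendsto f (𝓝[>] 0) (𝓝 0) := by
    refine squeeze_zero_norm' ?_ ((hcont.tendsto' 0 0 (by simp)).mono_left nhdsWithin_le_nhds)
    filter_upwards [Ioo_mem_nhdsGT one_pos] with s hs using hle s hs
  have h1 : Tendsto f (𝓝[<] 1) (𝓝 0) := by
    refine squeeze_zero_norm' ?_
      ((hcont.tendsto' 1 0 (by simp [gap])).mono_left nhdsWithin_le_nhds)
    filter_upwards [Ioo_mem_nhdsLT zero_lt_one] with s hs using hle s hs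
  rw [← intervalIntegral_zero_one_eq_setIntegral_Ioo,
    intervalIntegral.integral_eq_sub_of_hasDerivAt_of_tendsto one_pos hf
      ((intervalIntegrable_iff_integrableOn_Ioo_of_le zero_le_one).2 hint) h0 h1, sub_zero]

theorem integrable_arcsineMeasure_iff {b : ℝ → ℝ} :
    Integrable b (arcsineMeasure p) ↔ IntegrableOn (fun s => b s * weight p s) (Ioo 0 1) := by
  rw [arcsineMeasure, integrable_withDensity_iff_integrable_smul'
    (measurable_weight p).ennreal_ofReal (ae_of_all _ fun _ => ENNReal.ofReal_lt_top)]
  simp only [ENNReal.toReal_ofReal (weight_nonneg p _), smul_eq_mul, mul_comm]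
  rfl

theorem abs_div_gap_le {x C : ℝ} (hp : 0 ≤ p) (hs : s ∈ Ioo (0 : ℝ) 1) (hx : |x| ≤ C * gap p s) :
    |x / gap p s| ≤ C := by
  rwa [abs_div, abs_of_pos (gap_pos hp hs), div_le_iff₀ (gap_pos hp hs)]

theorem continuousOn_div_gap (hp : 0 ≤ p) {b : ℝ → ℝ} (hb : ContinuousOn b (Ioo 0 1)) :
    ContinuousOn (fun s => b s / gap p s) (Ioo 0 1) :=
  hb.div (continuous_gap hp).continuousOn fun _ hs => (gap_pos hp hs).ne'

theorem integrable_div_gap (hp : 0 ≤ p) {b : ℝ → ℝ} {C : ℝ} (hb : ContinuousOn b (Ioo 0 1))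
    (hC : ∀ s ∈ Ioo (0 : ℝ) 1, |b s| ≤ C * gap p s) :
    Integrable (fun s => b s / gap p s) (arcsineMeasure p) :=
  integrable_arcsineMeasure hp (continuousOn_div_gap hp hb)
    fun s hs => abs_div_gap_le hp hs (hC s hs)

theorem integrable_id_mul (hp : 0 ≤ p) {b : ℝ → ℝ} {C : ℝ} (hb : ContinuousOn b (Ioo 0 1))
    (hC : ∀ s ∈ Ioo (0 : ℝ) 1, |b s| ≤ C) :
    Integrable (fun s => s * b s) (arcsineMeasure p) :=
  integrable_arcsineMeasure hp (continuousOn_id.mul hb) fun s hs => by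
    rw [abs_mul, abs_of_pos hs.1]
    exact (mul_le_of_le_one_left (abs_nonneg _) hs.2.le).trans (hC s hs)

/-- Integration by parts: the derivative of `s * h s * weight p s` has integral zero. -/
theorem integral_div_gap_eq_sub {h h' : ℝ → ℝ} {C C' : ℝ} (hp : 0 ≤ p)
    (hh : ∀ s ∈ Ioo (0 : ℝ) 1, HasDerivAt h (h' s) s)
    (hC : ∀ s ∈ Ioo (0 : ℝ) 1, |h s| ≤ C * gap p s)
    (hh' : ContinuousOn h' (Ioo 0 1)) (hC' : ∀ s ∈ Ioo (0 : ℝ) 1, |h' s| ≤ C') :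
    (p + 1) / 2 * ∫ s, h s / gap p s ∂arcsineMeasure p =
      (p - 1) / 2 * (∫ s, h s ∂arcsineMeasure p) - ∫ s, s * h' s ∂arcsineMeasure p := by
  have hcont : ContinuousOn h (Ioo 0 1) := fun s hs => (hh s hs).continuousAt.continuousWithinAt
  have hquot := integrable_div_gap hp hcont hC
  have hint : Integrable h (arcsineMeasure p) :=
    integrable_arcsineMeasure (C := C) hp hcont fun s hs => (hC s hs).trans <|
      mul_le_of_le_one_right ((abs_nonneg _).trans (abs_div_gap_le hp hs (hC s hs)))
        (gap_le_one hs.1.le)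
  have hint' := integrable_id_mul hp hh' hC'
  have hdiff : Integrable (fun s => (p - 1) / 2 * h s - s * h' s) (arcsineMeasure p) :=
    (hint.const_mul _).sub hint'
  have hderiv : ∀ s ∈ Ioo (0 : ℝ) 1, HasDerivAt (fun s => s * h s * weight p s)
      (((p + 1) / 2 * (h s / gap p s) - ((p - 1) / 2 * h s - s * h' s)) * weight p s) s := by
    intro s hs
    have hg := (gap_pos hp hs).ne'
    refine (((hasDerivAt_id s).mul (hh s hs)).mul (hasDerivAt_weight hp hs)).congr_deriv ?_
    simp only [id, Pi.mul_apply]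
    rw [show s * h s * ((p + 1) / 2 * s ^ p / gap p s * weight p s) =
      (p + 1) / 2 * (h s / gap p s) * weight p s * (s * s ^ p) by ring, mul_rpow_self hs.1]
    field_simp
    ring
  have hzero := setIntegral_Ioo_deriv_eq_zero hp hderiv (integrable_arcsineMeasure_iff.1
    ((hquot.const_mul _).sub hdiff)) (C := C) fun s hs => by
      have := mul_nonneg hs.1.le (weight_nonneg p s)
      rw [← gap_mul_weight, abs_mul, abs_mul, abs_of_pos hs.1, abs_of_nonneg (weight_nonneg p s)]
      nlinarith [hC s hs]
  rw [← integral_arcsineMeasure, integral_sub (hquot.const_mul _) hdiff,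
    integral_sub (hint.const_mul _) hint', integral_const_mul, integral_const_mul] at hzero
  linarith

/-- The oscillating part of the potential difference, rescaled: the term `v * sin v ^ 2` of the
nonlinearity is `v / 2 - v * cos (2 * v) / 2`. -/
noncomputable def osc (α s : ℝ) : ℝ := ∫ t in s..1, 2 * t * Real.cos (2 * α * t)

theorem hasDerivAt_osc (α s : ℝ) : HasDerivAt (osc α) (-(2 * s * Real.cos (2 * α * s))) s := by
  have hcont : Continuous fun t => 2 * t * Real.cos (2 * α * t) := by fun_prop
  exact intervalIntegral.integral_hasDerivAt_left (hcont.intervalIntegrable _ _)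
    (hcont.stronglyMeasurableAtFilter _ _) hcont.continuousAt

theorem continuous_osc (α : ℝ) : Continuous (osc α) :=
  continuous_iff_continuousAt.2 fun s => (hasDerivAt_osc α s).continuousAt

theorem abs_osc_le (α : ℝ) (hs : s ∈ Ioo (0 : ℝ) 1) : |osc α s| ≤ 1 - s ^ 2 := by
  have hle : ∀ t ∈ Ioc s 1, ‖2 * t * Real.cos (2 * α * t)‖ ≤ 2 * t := fun t ht => by
    have := hs.1.trans ht.1
    rw [Real.norm_eq_abs, abs_mul, abs_of_pos (by positivity)]
    exact mul_le_of_le_one_right (by positivity) (Real.abs_cos_le_one _)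
  calc |osc α s| ≤ ∫ t in s..1, 2 * t :=
        intervalIntegral.norm_integral_le_of_norm_le hs.2.le (ae_of_all _ hle)
          ((continuous_const_mul 2).intervalIntegrable _ _)
    _ = 1 - s ^ 2 := by
        rw [intervalIntegral.integral_const_mul, integral_id]
        ring

theorem mul_osc {α : ℝ} (hα : α ≠ 0) (s : ℝ) :
    α * osc α s = Real.sin (2 * α) - s * Real.sin (2 * α * s) +
      (Real.cos (2 * α) - Real.cos (2 * α * s)) / (2 * α) := by
  have hderiv : ∀ t ∈ uIcc s 1, HasDerivAt
      (fun t => (t * Real.sin (2 * α * t) + Real.cos (2 * α * t) / (2 * α)) / α)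
      (2 * t * Real.cos (2 * α * t)) t := by
    intro t _
    have hlin := (hasDerivAt_id t).const_mul (2 * α)
    refine ((((hasDerivAt_id t).mul hlin.sin).add (hlin.cos.div_const (2 * α))).div_const
      α).congr_deriv ?_
    simp only [id]
    field_simp
    ring
  rw [osc, intervalIntegral.integral_eq_sub_of_hasDerivAt hderiv
    ((by fun_prop : Continuous fun t => 2 * t * Real.cos (2 * α * t)).intervalIntegrable _ _)]
  field_simp
  ring_nf

theorem abs_mul_osc_sub_le {α : ℝ} (hα : 0 < α) (s : ℝ) :
    |α * osc α s - (Real.sin (2 * α) - s * Real.sin (2 * α * s))| ≤ 1 / α := by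
  rw [mul_osc hα.ne', add_sub_cancel_left, abs_div, abs_of_pos (by positivity : 0 < 2 * α),
    div_le_div_iff₀ (by positivity) hα]
  have h : |Real.cos (2 * α) - Real.cos (2 * α * s)| ≤ 2 :=
    (abs_sub _ _).trans (by linarith [Real.abs_cos_le_one (2 * α), Real.abs_cos_le_one (2 * α * s)])
  nlinarith

theorem tendsto_osc (s : ℝ) : Tendsto (fun α => osc α s) atTop (𝓝 0) := by
  refine squeeze_zero_norm' (a := fun α => (1 + |s| + 1 / α) * α⁻¹) ?_ ?_
  · filter_upwards [eventually_gt_atTop 0] with α hα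
    have hmain : |Real.sin (2 * α) - s * Real.sin (2 * α * s)| ≤ 1 + |s| := by
      refine (abs_sub _ _).trans (add_le_add (Real.abs_sin_le_one _) ?_)
      rw [abs_mul]
      exact mul_le_of_le_one_right (abs_nonneg _) (Real.abs_sin_le_one _)
    have h := (abs_sub_abs_le_abs_sub _ _).trans (abs_mul_osc_sub_le hα s)
    rw [abs_mul, abs_of_pos hα] at h
    rw [Real.norm_eq_abs, ← div_eq_mul_inv, le_div_iff₀' hα]
    linarith
  · simpa using ((tendsto_inv_atTop_zero (𝕜 := ℝ)).const_add (1 + |s|)).mul tendsto_inv_atTop_zero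

/-- The error made in replacing `α * osc α s` by `sin (2 * α) - s * sin (2 * α * s)` under the
integral. -/
noncomputable def oscDefect (p α : ℝ) : ℝ :=
  ∫ s, (α * osc α s - (Real.sin (2 * α) - s * Real.sin (2 * α * s))) ∂arcsineMeasure p

theorem abs_oscDefect_le (hp : 0 ≤ p) {α : ℝ} (hα : 0 < α) : |oscDefect p α| ≤ C0 p / α := by
  rw [← one_div_mul_eq_div]
  exact abs_integral_arcsineMeasure_le hp fun s _ => abs_mul_osc_sub_le hα s

theorem tendsto_oscDefect (hp : 0 ≤ p) : Tendsto (oscDefect p) atTop (𝓝 0) := by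
  refine squeeze_zero_norm' (a := fun α => C0 p / α) ?_ (tendsto_id.const_div_atTop _)
  filter_upwards [eventually_gt_atTop 0] with α hα using abs_oscDefect_le hp hα

theorem integrable_osc (hp : 0 ≤ p) (α : ℝ) : Integrable (osc α) (arcsineMeasure p) :=
  integrable_arcsineMeasure (C := 1) hp (continuous_osc α).continuousOn fun s hs =>
    (abs_osc_le α hs).trans (sub_le_self _ (sq_nonneg s))

theorem integrable_sin_mul (hp : 0 ≤ p) (ω : ℝ) :
    Integrable (fun s => Real.sin (ω * s)) (arcsineMeasure p) :=
  integrable_arcsineMeasure hp (by fun_prop) fun _ _ => Real.abs_sin_le_one _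

theorem integrable_mul_sin_mul (hp : 0 ≤ p) (ω : ℝ) :
    Integrable (fun s => s * Real.sin (ω * s)) (arcsineMeasure p) :=
  integrable_id_mul hp (by fun_prop) fun _ _ => Real.abs_sin_le_one _

theorem integrable_mul_cos_mul (hp : 0 ≤ p) (ω : ℝ) :
    Integrable (fun s => s * Real.cos (ω * s)) (arcsineMeasure p) :=
  integrable_id_mul hp (by fun_prop) fun _ _ => Real.abs_cos_le_one _

theorem mul_integral_osc (hp : 0 ≤ p) (α : ℝ) :
    α * ∫ s, osc α s ∂arcsineMeasure p =
      (∫ s, (Real.sin (2 * α) - s * Real.sin (2 * α * s)) ∂arcsineMeasure p) + oscDefect p α := by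
  have := isFiniteMeasure_arcsineMeasure hp
  have hmain : Integrable (fun s => Real.sin (2 * α) - s * Real.sin (2 * α * s))
    (arcsineMeasure p) := (integrable_const _).sub (integrable_mul_sin_mul hp _)
  rw [oscDefect, integral_sub ((integrable_osc hp α).const_mul α) hmain, integral_const_mul,
    add_sub_cancel]

theorem mul_integral_osc_eq_E2 (hp : 0 ≤ p) (α : ℝ) :
    -((p + 1) / 8) * (α * ∫ s, osc α s ∂arcsineMeasure p) =
      E2 p α - (p + 1) / 8 * oscDefect p α := by
  rw [mul_integral_osc hp, E2_eq (by linarith)]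
  ring

theorem abs_one_sub_mul_sin_le (hp : 0 ≤ p) (hs : s ∈ Ioo (0 : ℝ) 1) (ω : ℝ) :
    |(1 - s) * Real.sin (ω * s)| ≤ 1 * gap p s := by
  rw [abs_mul, abs_of_pos (sub_pos.2 hs.2), one_mul]
  exact (mul_le_of_le_one_right (sub_pos.2 hs.2).le (Real.abs_sin_le_one _)).trans
    (one_sub_le_gap hp hs)

theorem abs_osc_le_two_mul_gap (hp : 0 ≤ p) (hs : s ∈ Ioo (0 : ℝ) 1) (α : ℝ) :
    |osc α s| ≤ 2 * gap p s :=
  (abs_osc_le α hs).trans (one_sub_sq_le_two_mul_gap hp hs)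

/-- Integration by parts, applied to a function whose derivative contains the integrand of `C11`
multiplied by the large parameter `α`. -/
theorem integral_mul_osc_sub_div_gap (hp : 0 ≤ p) (α : ℝ) :
    (p + 1) / 2 * ∫ s, (α * osc α s - (1 - s) * Real.sin (2 * α * s)) / gap p s ∂arcsineMeasure p =
      (p - 1) / 2 * (∫ s, (α * osc α s - (1 - s) * Real.sin (2 * α * s)) ∂arcsineMeasure p) -
        ∫ s, s * (Real.sin (2 * α * s) - 2 * α * Real.cos (2 * α * s)) ∂arcsineMeasure p := by
  refine integral_div_gap_eq_sub hp (C := 2 * |α| + 1) (C' := 1 + |2 * α|) (fun s _ => ?_)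
    (fun s hs => ?_) (by fun_prop) fun s _ => ?_
  · have hsin := ((hasDerivAt_id s).const_mul (2 * α)).sin
    refine (((hasDerivAt_osc α s).const_mul α).sub
      (((hasDerivAt_id s).const_sub 1).mul hsin)).congr_deriv ?_
    simp only [id]
    ring
  · refine (abs_sub _ _).trans ?_
    rw [abs_mul, add_mul]
    refine add_le_add ?_ (abs_one_sub_mul_sin_le hp hs _)
    rw [mul_comm 2, mul_assoc]
    exact mul_le_mul_of_nonneg_left (abs_osc_le_two_mul_gap hp hs α) (abs_nonneg α)
  · refine (abs_sub _ _).trans (add_le_add (Real.abs_sin_le_one _) ?_)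
    rw [abs_mul]
    exact mul_le_of_le_one_right (abs_nonneg _) (Real.abs_cos_le_one _)

theorem mul_integral_osc_div_gap_sub_C11 (hp : 0 ≤ p) (α : ℝ) :
    α * ((p + 1) / 4 * (∫ s, osc α s / gap p s ∂arcsineMeasure p) - C11 p α) =
      C12 p α + C21 p α + (p - 1) / 4 * oscDefect p α := by
  have := isFiniteMeasure_arcsineMeasure hp
  have hsin := integrable_mul_sin_mul hp (2 * α)
  have hgap : ∫ s, (α * osc α s - (1 - s) * Real.sin (2 * α * s)) / gap p s ∂arcsineMeasure p =
      α * (∫ s, osc α s / gap p s ∂arcsineMeasure p) -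
        ∫ s, (1 - s) * Real.sin (2 * α * s) / gap p s ∂arcsineMeasure p := by
    simp only [sub_div, mul_div_assoc α]
    rw [← integral_const_mul]
    exact integral_sub ((integrable_div_gap hp (continuous_osc α).continuousOn
      fun s hs => abs_osc_le_two_mul_gap hp hs α).const_mul α)
      (integrable_div_gap hp (by fun_prop) fun s hs => abs_one_sub_mul_sin_le hp hs (2 * α))
  have hdefect : ∫ s, (α * osc α s - (1 - s) * Real.sin (2 * α * s)) ∂arcsineMeasure p =
      oscDefect p α + ∫ s, (Real.sin (2 * α) - Real.sin (2 * α * s)) ∂arcsineMeasure p := by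
    refine (integral_congr_ae (ae_of_all _ fun s => ?_)).trans
      (integral_add (((integrable_osc hp α).const_mul α).sub ((integrable_const _).sub hsin))
        ((integrable_const _).sub (integrable_sin_mul hp (2 * α))))
    ring
  have hself : ∫ s, s * (Real.sin (2 * α * s) - 2 * α * Real.cos (2 * α * s)) ∂arcsineMeasure p =
      (∫ s, s * Real.sin (2 * α * s) ∂arcsineMeasure p) -
        2 * α * ∫ s, s * Real.cos (2 * α * s) ∂arcsineMeasure p := by
    rw [← integral_const_mul, ← integral_sub hsin ((integrable_mul_cos_mul hp _).const_mul _)]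
    congr with s
    ring
  have hparts := integral_mul_osc_sub_div_gap hp α
  rw [hgap, hdefect, hself] at hparts
  rw [C11_eq (by linarith), C12_eq hp, C21_eq (by linarith)]
  linear_combination 1 / 2 * hparts

theorem integrableOn_primitive {F : ℝ → ℝ} {C : ℝ} (hF : ContinuousOn F (Ico 0 1))
    (hC : ∀ y ∈ Ioo (0 : ℝ) 1, |F y| ≤ C * (1 - y) ^ (-(3 / 2) : ℝ)) :
    IntegrableOn (fun s => ∫ y in (0 : ℝ)..s, F y) (Ioo 0 1) := by
  have hpow : ContinuousOn (fun y : ℝ => (1 - y) ^ (-(3 / 2) : ℝ)) (Ico 0 1) :=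
    (by fun_prop : ContinuousOn (fun y : ℝ => 1 - y) _).rpow_const
      fun y hy => Or.inl (sub_pos.2 hy.2).ne'
  have hsub : ∀ s ∈ Ioo (0 : ℝ) 1, uIcc 0 s ⊆ Ico 0 1 := fun s hs => by
    rw [uIcc_of_le hs.1.le]
    exact fun y hy => ⟨hy.1, hy.2.trans_lt hs.2⟩
  have hcont : ContinuousOn (fun s => ∫ y in (0 : ℝ)..s, F y) (Ioo 0 1) := fun s hs =>
    (intervalIntegral.integral_hasDerivAt_right (hF.mono (hsub s hs)).intervalIntegrable
      ((hF.mono Ioo_subset_Ico_self).stronglyMeasurableAtFilter isOpen_Ioo s hs)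
      ((hF.mono Ioo_subset_Ico_self).continuousAt
        (Ioo_mem_nhds hs.1 hs.2))).continuousAt.continuousWithinAt
  refine ((integrableOn_one_sub_rpow (r := -(1 / 2)) (by norm_num)).const_mul (2 * C)).mono'
    (hcont.aestronglyMeasurable measurableSet_Ioo)
    (ae_restrict_of_forall_mem measurableSet_Ioo fun s hs => ?_)
  have hC0 : 0 ≤ C := nonneg_of_mul_nonneg_left ((abs_nonneg _).trans (hC s hs))
    (Real.rpow_pos_of_pos (sub_pos.2 hs.2) _)
  calc ‖∫ y in (0 : ℝ)..s, F y‖ ≤ ∫ y in (0 : ℝ)..s, C * (1 - y) ^ (-(3 / 2) : ℝ) :=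
        intervalIntegral.norm_integral_le_of_norm_le hs.1.le
          (ae_of_all _ fun y hy => hC y ⟨hy.1, hy.2.trans_lt hs.2⟩)
          ((hpow.mono (hsub s hs)).intervalIntegrable.const_mul C)
    _ = 2 * C * (1 - s) ^ (-(1 / 2) : ℝ) - 2 * C := by
        rw [intervalIntegral.integral_const_mul,
          intervalIntegral.integral_comp_sub_left (fun y : ℝ => y ^ (-(3 / 2) : ℝ)), sub_zero,
          integral_rpow (Or.inr ⟨by norm_num, fun h => ?_⟩)]
        · norm_num
          ring
        · rw [uIcc_of_le (by linarith [hs.1])] at h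
          linarith [h.1, hs.2]
    _ ≤ 2 * C * (1 - s) ^ (-(1 / 2) : ℝ) := by linarith

theorem tendsto_integral_mul_cos {ψ : ℝ → ℝ} (hψ : Integrable ψ) :
    Tendsto (fun ω : ℝ => ∫ s, ψ s * Real.cos (ω * s)) atTop (𝓝 0) := by
  have hfreq : Tendsto (fun ω : ℝ => -(ω / (2 * Real.pi))) atTop (cocompact ℝ) :=
    (tendsto_neg_atTop_atBot.comp (tendsto_id.atTop_div_const Real.two_pi_pos)).mono_right
      atBot_le_cocompact
  have hlim := (Complex.continuous_re.tendsto 0).comp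
    ((Real.tendsto_integral_exp_smul_cocompact fun s => (ψ s : ℂ)).comp hfreq)
  rw [Complex.zero_re] at hlim
  refine hlim.congr fun ω => ?_
  have hchar : ∀ s : ℝ, (Real.fourierChar (-(s * -(ω / (2 * Real.pi)))) : Circle) • (ψ s : ℂ) =
      ψ s * Complex.exp ((ω * s : ℝ) * Complex.I) := by
    intro s
    rw [Circle.smul_def, Real.fourierChar_apply, smul_eq_mul, mul_comm]
    congr 3
    push_cast
    have := Complex.ofReal_ne_zero.2 Real.pi_ne_zero
    field_simp
  have hint : Integrable fun s : ℝ => (ψ s * Complex.exp ((ω * s : ℝ) * Complex.I) : ℂ) :=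
    hψ.ofReal.mul_bdd (c := 1) (Continuous.aestronglyMeasurable (by fun_prop))
      (ae_of_all _ fun s => (Complex.norm_exp_ofReal_mul_I _).le)
  simp only [Function.comp_apply, hchar]
  refine (integral_re hint).symm.trans (integral_congr_ae (ae_of_all _ fun s => ?_))
  simp only [RCLike.re_to_complex, Complex.re_ofReal_mul, Complex.exp_ofReal_mul_I_re]

theorem gap_pos_of_mem_Ico (hp : 0 ≤ p) (hs : s ∈ Ico (0 : ℝ) 1) : 0 < gap p s := by
  rcases hs.1.eq_or_lt with rfl | h
  · rw [gap, Real.zero_rpow (by linarith), sub_zero]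
    exact one_pos
  · exact gap_pos hp ⟨h, hs.2⟩

theorem abs_C3_integrand_le (hp : 0 ≤ p) (hs : s ∈ Ioo (0 : ℝ) 1) :
    |(1 - s ^ 2) / gap p s ^ (5 / 2 : ℝ)| ≤ 2 * (1 - s) ^ (-(3 / 2) : ℝ) := by
  have hg := gap_pos hp hs
  have h1 : 0 < 1 - s := sub_pos.2 hs.2
  have h0 : 0 ≤ 1 - s ^ 2 := by nlinarith [hs.1]
  rw [abs_of_nonneg (by positivity), Real.rpow_neg h1.le, ← div_eq_mul_inv,
    div_le_div_iff₀ (by positivity) (by positivity), show (5 / 2 : ℝ) = 1 + 3 / 2 by norm_num,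
    Real.rpow_add hg, Real.rpow_one, ← mul_assoc]
  gcongr
  · exact one_sub_sq_le_two_mul_gap hp hs
  · exact one_sub_le_gap hp hs

theorem tendsto_C3 (hp : 0 ≤ p) : Tendsto (C3 p) atTop (𝓝 0) := by
  have hcont : ContinuousOn (fun y => (1 - y ^ 2) / gap p y ^ (5 / 2 : ℝ)) (Ico 0 1) :=
    ContinuousOn.div (by fun_prop)
      ((continuous_gap hp).continuousOn.rpow_const fun _ _ => Or.inr (by norm_num))
      fun y hy => (Real.rpow_pos_of_pos (gap_pos_of_mem_Ico hp hy) _).ne'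
  have hint := integrableOn_primitive hcont fun y hy => abs_C3_integrand_le hp hy
  have hlim := ((tendsto_integral_mul_cos (hint.integrable_indicator measurableSet_Ioo)).comp
    (tendsto_id.const_mul_atTop (two_pos (α := ℝ)))).const_mul (-(3 / 32) * (p + 1) ^ 2)
  rw [mul_zero] at hlim
  refine hlim.congr fun α => ?_
  rw [C3, intervalIntegral_zero_one_eq_setIntegral_Ioo, ← integral_indicator measurableSet_Ioo]
  simp only [Function.comp_apply, id, indicator_mul_left]
  rfl

/-! ### Expansion of the time map and the action -/

theorem exists_one_add_eq_one_add_sq {x : ℝ} (hx : 0 ≤ x) : ∃ u, 0 ≤ u ∧ x = u ^ 2 + 2 * u := by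
  refine ⟨√(1 + x) - 1, sub_nonneg.2 (Real.one_le_sqrt.2 (by linarith)), ?_⟩
  nlinarith [Real.sq_sqrt (by linarith : 0 ≤ 1 + x)]

theorem sqrt_one_add_sq_add_two_mul {u : ℝ} (hu : 0 ≤ u) : √(1 + (u ^ 2 + 2 * u)) = 1 + u := by
  rw [show 1 + (u ^ 2 + 2 * u) = (1 + u) ^ 2 by ring, Real.sqrt_sq (by linarith)]

theorem abs_one_div_sqrt_one_add_sub_le {x : ℝ} (hx : 0 ≤ x) :
    |1 / √(1 + x) - (1 + -(1 / 2) * x + 3 / 8 * x ^ 2)| ≤ x ^ 3 := by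
  obtain ⟨u, hu, rfl⟩ := exists_one_add_eq_one_add_sq hx
  have hrem : 1 / (1 + u) - (1 + -(1 / 2) * (u ^ 2 + 2 * u) + 3 / 8 * (u ^ 2 + 2 * u) ^ 2) =
      -(u ^ 3 * ((20 + 15 * u + 3 * u ^ 2) / 8) / (1 + u)) := by
    field_simp
    ring
  rw [sqrt_one_add_sq_add_two_mul hu, hrem, abs_neg, abs_of_nonneg (by positivity),
    div_le_iff₀ (by positivity), ← sub_nonneg,
    show (u ^ 2 + 2 * u) ^ 3 * (1 + u) - u ^ 3 * ((20 + 15 * u + 3 * u ^ 2) / 8) =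
      u ^ 3 * (11 / 2 + 145 / 8 * u + 141 / 8 * u ^ 2 + 7 * u ^ 3 + u ^ 4) by ring]
  positivity

theorem continuousOn_one_div_sqrt_one_add :
    ContinuousOn (fun x : ℝ => 1 / √(1 + x)) (Ici 0) :=
  continuousOn_const.div (by fun_prop) fun x (hx : 0 ≤ x) => by positivity

theorem abs_sqrt_one_add_sub_le {x : ℝ} (hx : 0 ≤ x) :
    |√(1 + x) - (1 + 1 / 2 * x + -(1 / 8) * x ^ 2)| ≤ x ^ 3 := by
  obtain ⟨u, hu, rfl⟩ := exists_one_add_eq_one_add_sq hx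
  rw [sqrt_one_add_sq_add_two_mul hu,
    show 1 + u - (1 + 1 / 2 * (u ^ 2 + 2 * u) + -(1 / 8) * (u ^ 2 + 2 * u) ^ 2) =
      u ^ 3 * (1 / 2 + u / 8) by ring, abs_of_nonneg (by positivity), ← sub_nonneg,
    show (u ^ 2 + 2 * u) ^ 3 - u ^ 3 * (1 / 2 + u / 8) =
      u ^ 3 * (15 / 2 + 95 / 8 * u + 6 * u ^ 2 + u ^ 3) by ring]
  positivity

theorem abs_integral_comp_mul_sub_le {Φ r b : ℝ → ℝ} {c₁ c₂ ε M : ℝ} (hp : 0 ≤ p)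
    (hΦ : ContinuousOn Φ (Ici 0))
    (hTaylor : ∀ x, 0 ≤ x → |Φ x - (1 + c₁ * x + c₂ * x ^ 2)| ≤ x ^ 3)
    (hr : ContinuousOn r (Ioo 0 1)) (hrM : ∀ s ∈ Ioo (0 : ℝ) 1, r s ∈ Icc 0 M)
    (hb : ContinuousOn b (Ioo 0 1)) (hb1 : ∀ s ∈ Ioo (0 : ℝ) 1, |b s| ≤ 1) (hε : 0 ≤ ε) :
    |∫ s, Φ (ε * r s) * b s ∂arcsineMeasure p - (∫ s, b s ∂arcsineMeasure p +
      c₁ * (ε * ∫ s, r s * b s ∂arcsineMeasure p) +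
      c₂ * (ε ^ 2 * ∫ s, r s ^ 2 * b s ∂arcsineMeasure p))| ≤ (ε * M) ^ 3 * C0 p := by
  set e : ℝ → ℝ := fun s => Φ (ε * r s) - (1 + c₁ * (ε * r s) + c₂ * (ε * r s) ^ 2)
  have hεr : ContinuousOn (fun s => ε * r s) (Ioo 0 1) := hr.const_mul ε
  have he : ContinuousOn e (Ioo 0 1) :=
    (hΦ.comp hεr fun s hs => mul_nonneg hε (hrM s hs).1).sub (by fun_prop)
  have heb_le : ∀ s ∈ Ioo (0 : ℝ) 1, |e s * b s| ≤ (ε * M) ^ 3 := fun s hs => by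
    have h0 := mul_nonneg hε (hrM s hs).1
    have hle := mul_le_mul_of_nonneg_left (hrM s hs).2 hε
    rw [abs_mul]
    exact (mul_le_of_le_one_right (abs_nonneg _) (hb1 s hs)).trans
      ((hTaylor _ h0).trans (pow_le_pow_left₀ h0 hle 3))
  have hpow : ∀ n : ℕ, Integrable (fun s => r s ^ n * b s) (arcsineMeasure p) := fun n =>
    integrable_arcsineMeasure (C := M ^ n) hp ((hr.pow n).mul hb) fun s hs => by
      rw [abs_mul, abs_of_nonneg (pow_nonneg (hrM s hs).1 n)]
      exact (mul_le_of_le_one_right (pow_nonneg (hrM s hs).1 n) (hb1 s hs)).trans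
        (pow_le_pow_left₀ (hrM s hs).1 (hrM s hs).2 n)
  have hsplit : ∫ s, Φ (ε * r s) * b s ∂arcsineMeasure p = ∫ s, e s * b s ∂arcsineMeasure p +
      (∫ s, b s ∂arcsineMeasure p + c₁ * (ε * ∫ s, r s * b s ∂arcsineMeasure p) +
        c₂ * (ε ^ 2 * ∫ s, r s ^ 2 * b s ∂arcsineMeasure p)) := by
    have h0 : Integrable b (arcsineMeasure p) := by simpa only [pow_zero, one_mul] using hpow 0
    have h1 : Integrable (fun s => c₁ * ε * (r s * b s)) (arcsineMeasure p) := by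
      simpa only [pow_one] using (hpow 1).const_mul (c₁ * ε)
    have h01 : Integrable (fun s => b s + c₁ * ε * (r s * b s)) (arcsineMeasure p) := h0.add h1
    have h2 := (hpow 2).const_mul (c₂ * ε ^ 2)
    rw [← mul_assoc, ← mul_assoc, ← integral_const_mul, ← integral_const_mul,
      ← integral_add h0 h1, ← integral_add h01 h2]
    refine (integral_congr_ae (ae_of_all _ fun s => ?_)).trans
      (integral_add (integrable_arcsineMeasure hp (he.mul hb) heb_le) (h01.add h2))
    simp only [e]
    ring
  rw [hsplit, add_sub_cancel_right]
  exact abs_integral_arcsineMeasure_le hp heb_le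

/-- The size of the perturbation caused by the term `v * sin v ^ 2` at amplitude `α`, relative to
the leading potential difference. -/
noncomputable def eps (p α : ℝ) : ℝ := (p + 1) / 4 * α ^ (1 - p)

/-- The bounded profile of the same perturbation at `v = α * s`. -/
noncomputable def ratio (p α s : ℝ) : ℝ := (1 - s ^ 2 - osc α s) / gap p s

/-- The rescaled half period of the solution of amplitude `α`. -/
noncomputable def scaledTime (p α : ℝ) : ℝ :=
  ∫ s, 1 / √(1 + eps p α * ratio p α s) ∂arcsineMeasure p

/-- The rescaled integral of `v'` times `dv` along a quarter of the phase curve of amplitude `α`. -/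
noncomputable def scaledAction (p α : ℝ) : ℝ :=
  ∫ s, √(1 + eps p α * ratio p α s) * gap p s ∂arcsineMeasure p

/-- The order up to which the expansion in `α` is made. -/
noncomputable def errorScale (p α : ℝ) : ℝ := α ^ (2 * (1 - p)) + α ^ (-p)

theorem continuousOn_ratio (hp : 0 ≤ p) (α : ℝ) : ContinuousOn (ratio p α) (Ioo 0 1) :=
  continuousOn_div_gap hp ((by fun_prop : Continuous fun s : ℝ => 1 - s ^ 2).sub
    (continuous_osc α)).continuousOn

theorem ratio_mem_Icc (hp : 0 ≤ p) (hs : s ∈ Ioo (0 : ℝ) 1) (α : ℝ) : ratio p α s ∈ Icc 0 4 := by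
  have hosc := abs_le.1 (abs_osc_le α hs)
  have hg := gap_pos hp hs
  rw [ratio]
  refine ⟨div_nonneg (by linarith) hg.le, (div_le_iff₀ hg).2 ?_⟩
  linarith [one_sub_sq_le_two_mul_gap hp hs]

theorem tendsto_integral_ratio_sq_mul {b : ℝ → ℝ} (hp : 0 ≤ p) (hb : ContinuousOn b (Ioo 0 1))
    (hb1 : ∀ s ∈ Ioo (0 : ℝ) 1, |b s| ≤ 1) :
    Tendsto (fun α => ∫ s, ratio p α s ^ 2 * b s ∂arcsineMeasure p) atTop
      (𝓝 (∫ s, ((1 - s ^ 2) / gap p s) ^ 2 * b s ∂arcsineMeasure p)) := by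
  have := isFiniteMeasure_arcsineMeasure hp
  refine tendsto_integral_filter_of_norm_le_const (Eventually.of_forall fun α =>
    aestronglyMeasurable_arcsineMeasure (((continuousOn_ratio hp α).pow 2).mul hb))
    ⟨4 ^ 2, Eventually.of_forall fun α => ae_arcsineMeasure_of_forall_mem_Ioo fun s hs => ?_⟩
    (ae_of_all _ fun s => ?_)
  · obtain ⟨h0, h4⟩ := ratio_mem_Icc hp hs α
    rw [norm_mul, norm_pow, Real.norm_of_nonneg h0]
    exact (mul_le_of_le_one_right (by positivity) (hb1 s hs)).trans (pow_le_pow_left₀ h0 h4 2)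
  · have h := ((((tendsto_osc s).const_sub (1 - s ^ 2)).div_const (gap p s)).pow 2).mul_const (b s)
    rwa [sub_zero] at h

theorem eps_mul_integral_ratio (hp : 0 ≤ p) {α : ℝ} (hα : 0 < α) :
    -(1 / 2) * (eps p α * ∫ s, ratio p α s ∂arcsineMeasure p) =
      (C1 p + 1 / 2 * C11 p α) * α ^ (1 - p) +
        1 / 2 * (C12 p α + C21 p α + (p - 1) / 4 * oscDefect p α) * α ^ (-p) := by
  have hsplit : ∫ s, ratio p α s ∂arcsineMeasure p =
      (∫ s, (1 - s ^ 2) / gap p s ∂arcsineMeasure p) -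
        ∫ s, osc α s / gap p s ∂arcsineMeasure p := by
    simp only [ratio, sub_div _ (osc _ _)]
    refine integral_sub (integrable_div_gap (C := 2) hp (by fun_prop) fun s hs => ?_)
      (integrable_div_gap hp (continuous_osc α).continuousOn
        fun s hs => abs_osc_le_two_mul_gap hp hs α)
    rw [abs_of_nonneg (by nlinarith [hs.1, hs.2])]
    exact one_sub_sq_le_two_mul_gap hp hs
  rw [← mul_integral_osc_div_gap_sub_C11 hp, hsplit, C1_eq hp, eps, sub_eq_neg_add 1 p,
    Real.rpow_add_one hα.ne']
  ring

theorem eps_mul_integral_ratio_mul_gap (hp : 0 ≤ p) {α : ℝ} (hα : 0 < α) :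
    1 / 2 * (eps p α * ∫ s, ratio p α s * gap p s ∂arcsineMeasure p) =
      E1 p * α ^ (1 - p) + (E2 p α - (p + 1) / 8 * oscDefect p α) * α ^ (-p) := by
  have hsplit : ∫ s, ratio p α s * gap p s ∂arcsineMeasure p =
      (∫ s, (1 - s ^ 2) ∂arcsineMeasure p) - ∫ s, osc α s ∂arcsineMeasure p := by
    rw [← integral_sub (integrable_arcsineMeasure (C := 1) hp (by fun_prop) fun s hs => ?_)
      (integrable_osc hp α)]
    · exact integral_arcsineMeasure_congr fun s hs => div_mul_cancel₀ _ (gap_pos hp hs).ne'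
    · rw [abs_of_nonneg (by nlinarith [hs.1, hs.2])]
      exact sub_le_self _ (sq_nonneg s)
  rw [← mul_integral_osc_eq_E2 hp, hsplit, E1_eq, eps, sub_eq_neg_add 1 p,
    Real.rpow_add_one hα.ne']
  ring

theorem eps_nonneg (hp : 0 ≤ p) {α : ℝ} (hα : 0 ≤ α) : 0 ≤ eps p α := by
  unfold eps
  positivity

theorem eps_sq {α : ℝ} (hα : 0 ≤ α) :
    eps p α ^ 2 = (p + 1) ^ 2 / 16 * α ^ (2 * (1 - p)) := by
  rw [eps, mul_pow, mul_comm 2, Real.rpow_mul hα, Real.rpow_two]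
  ring

theorem tendsto_rpow_one_sub (hp : 1 < p) : Tendsto (fun α : ℝ => α ^ (1 - p)) atTop (𝓝 0) := by
  simpa only [neg_sub] using tendsto_rpow_neg_atTop (sub_pos.2 hp)

theorem tendsto_errorScale (hp : 1 < p) : Tendsto (errorScale p) atTop (𝓝 0) := by
  have h1 := tendsto_rpow_neg_atTop (y := 2 * (p - 1)) (by linarith)
  have h2 := tendsto_rpow_neg_atTop (y := p) (by linarith)
  have h := h1.add h2
  simp only [neg_mul_eq_mul_neg, neg_sub, add_zero] at h
  exact h

theorem rpow_two_mul_one_sub_isBigO (p : ℝ) :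
    (fun α : ℝ => α ^ (2 * (1 - p))) =O[atTop] errorScale p := by
  refine IsBigO.of_bound' ?_
  filter_upwards [eventually_ge_atTop 0] with α hα
  rw [Real.norm_of_nonneg (by positivity), errorScale, Real.norm_of_nonneg (by positivity)]
  exact le_add_of_nonneg_right (by positivity)

theorem rpow_neg_isBigO (p : ℝ) : (fun α : ℝ => α ^ (-p)) =O[atTop] errorScale p := by
  refine IsBigO.of_bound' ?_
  filter_upwards [eventually_ge_atTop 0] with α hα
  rw [Real.norm_of_nonneg (by positivity), errorScale, Real.norm_of_nonneg (by positivity)]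
  exact le_add_of_nonneg_left (by positivity)

theorem eps_pow_three_isLittleO (hp : 1 < p) (c : ℝ) :
    (fun α => (eps p α * 4) ^ 3 * c) =o[atTop] errorScale p := by
  have hlim : Tendsto (fun α => (p + 1) ^ 2 / 16 * 64 * c * eps p α) atTop (𝓝 0) := by
    have h := ((tendsto_rpow_one_sub hp).const_mul ((p + 1) / 4)).const_mul
      ((p + 1) ^ 2 / 16 * 64 * c)
    rwa [mul_zero, mul_zero] at h
  have h := ((isLittleO_one_iff ℝ).2 hlim).mul_isBigO (rpow_two_mul_one_sub_isBigO p)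
  simp only [one_mul] at h
  refine h.congr' ?_ .rfl
  filter_upwards [eventually_ge_atTop 0] with α hα
  rw [mul_pow, pow_succ (eps p α), eps_sq hα]
  ring

theorem integral_arcsineMeasure_isBigO_one {b : ℝ → ℝ → ℝ} {C : ℝ} (hp : 0 ≤ p)
    (hC : ∀ α, ∀ s ∈ Ioo (0 : ℝ) 1, |b α s| ≤ C) (l : Filter ℝ) :
    (fun α => ∫ s, b α s ∂arcsineMeasure p) =O[l] fun _ => (1 : ℝ) :=
  .of_bound (C * C0 p) <| Eventually.of_forall fun α => by
    rw [norm_one, mul_one]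
    exact abs_integral_arcsineMeasure_le hp (hC α)

theorem C11_isBigO_one (hp : 0 ≤ p) : C11 p =O[atTop] fun _ => (1 : ℝ) := by
  simp only [funext (C11_eq (by linarith : -1 < p))]
  refine integral_arcsineMeasure_isBigO_one (C := 1) hp (fun α s hs => ?_) _
  rw [abs_mul, abs_of_pos hs.1]
  exact mul_le_one₀ hs.2.le (abs_nonneg _) (Real.abs_cos_le_one _)

theorem abs_mul_sin_mul_le_one (hs : s ∈ Ioo (0 : ℝ) 1) (x : ℝ) : |s * Real.sin x| ≤ 1 := by
  rw [abs_mul, abs_of_pos hs.1]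
  exact mul_le_one₀ hs.2.le (abs_nonneg _) (Real.abs_sin_le_one _)

theorem C21_isBigO_one (hp : 0 ≤ p) : C21 p =O[atTop] fun _ => (1 : ℝ) := by
  simp only [funext (C21_eq (by linarith : -1 < p))]
  exact (integral_arcsineMeasure_isBigO_one hp
    (fun α s hs => abs_mul_sin_mul_le_one hs _) _).const_mul_left _

theorem E2_isBigO_one (hp : 0 ≤ p) : E2 p =O[atTop] fun _ => (1 : ℝ) := by
  simp only [funext (E2_eq (by linarith : -1 < p))]
  exact (integral_arcsineMeasure_isBigO_one hp (fun α s hs => (abs_sub _ _).trans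
    (add_le_add (Real.abs_sin_le_one _) (abs_mul_sin_mul_le_one hs _))) _).const_mul_left _

theorem C12_isBigO_one (hp : 0 ≤ p) : C12 p =O[atTop] fun _ => (1 : ℝ) := by
  simp only [funext (C12_eq hp)]
  refine ((integral_arcsineMeasure_isBigO_one hp (fun _ s _ => (abs_sub _ _).trans
    (add_le_add (Real.abs_sin_le_one _) (Real.abs_sin_le_one _))) _).const_mul_left _).add
    ((integral_arcsineMeasure_isBigO_one (C := 1) hp (fun α s hs => ?_) _).const_mul_left _)
  exact abs_div_gap_le hp hs (abs_one_sub_mul_sin_le hp hs (2 * α))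

theorem tendsto_mul_of_isBigO_one {f g : ℝ → ℝ} {l : Filter ℝ} (hf : f =O[l] fun _ => (1 : ℝ))
    (hg : Tendsto g l (𝓝 0)) : Tendsto (fun x => f x * g x) l (𝓝 0) := by
  simpa only [mul_one, isLittleO_one_iff] using hf.mul_isLittleO ((isLittleO_one_iff ℝ).2 hg)

theorem mul_isLittleO_of_tendsto_zero {f g δ : ℝ → ℝ} {l : Filter ℝ} (hf : Tendsto f l (𝓝 0))
    (hg : g =O[l] δ) : (fun x => f x * g x) =o[l] δ := by
  simpa only [one_mul] using ((isLittleO_one_iff ℝ).2 hf).mul_isBigO hg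

theorem mul_isBigO_of_isBigO_one {f g δ : ℝ → ℝ} {l : Filter ℝ} (hf : f =O[l] fun _ => (1 : ℝ))
    (hg : g =O[l] δ) : (fun x => f x * g x) =O[l] δ := by
  simpa only [one_mul] using hf.mul hg

theorem isLittleO_of_abs_sub_le {f g h δ : ℝ → ℝ} {l : Filter ℝ}
    (hfg : ∀ᶠ x in l, |f x - g x| ≤ h x) (hh : h =o[l] δ) : (fun x => f x - g x) =o[l] δ :=
  (IsBigO.of_bound' (hfg.mono fun _ hx => hx.trans (le_abs_self _))).trans_isLittleO hh

theorem scaledTime_isLittleO (hp : 1 < p) :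
    (fun α => scaledTime p α - (C0 p + (C1 p + 1 / 2 * C11 p α) * α ^ (1 - p) +
      ((C2 p + C3 p α) * α ^ (2 * (1 - p)) + 1 / 2 * (C12 p α + C21 p α) * α ^ (-p))))
      =o[atTop] errorScale p := by
  have hp0 : 0 ≤ p := by linarith
  have hTaylor : (fun α => scaledTime p α - (C0 p +
      -(1 / 2) * (eps p α * ∫ s, ratio p α s ∂arcsineMeasure p) +
      3 / 8 * (eps p α ^ 2 * ∫ s, ratio p α s ^ 2 ∂arcsineMeasure p))) =o[atTop] errorScale p := by
    refine isLittleO_of_abs_sub_le ?_ (eps_pow_three_isLittleO hp (C0 p))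
    filter_upwards [eventually_ge_atTop 0] with α hα
    have h := abs_integral_comp_mul_sub_le (Φ := fun x => 1 / √(1 + x)) (b := fun _ => 1) hp0
      continuousOn_one_div_sqrt_one_add (fun x => abs_one_div_sqrt_one_add_sub_le)
      (continuousOn_ratio hp0 α) (fun s hs => ratio_mem_Icc hp0 hs α) continuousOn_const
      (fun _ _ => abs_one.le) (eps_nonneg hp0 hα)
    simpa only [mul_one, integral_const, smul_eq_mul, ← C0_eq, scaledTime] using h
  have hC2 : Tendsto (fun α => 3 * (p + 1) ^ 2 / 128 * (∫ s, ratio p α s ^ 2 ∂arcsineMeasure p) -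
      (C2 p + C3 p α)) atTop (𝓝 0) := by
    have h := (tendsto_integral_ratio_sq_mul hp0 (b := fun _ => 1) continuousOn_const
      fun _ _ => abs_one.le).const_mul (3 * (p + 1) ^ 2 / 128)
    simp only [mul_one, ← C2_eq hp0] at h
    simpa using h.sub ((tendsto_C3 hp0).const_add (C2 p))
  have hdefect := (tendsto_oscDefect hp0).const_mul (1 / 2 * ((p - 1) / 4))
  rw [mul_zero] at hdefect
  refine ((hTaylor.add (mul_isLittleO_of_tendsto_zero hC2 (rpow_two_mul_one_sub_isBigO p))).add
    (mul_isLittleO_of_tendsto_zero hdefect (rpow_neg_isBigO p))).congr' ?_ .rfl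
  filter_upwards [eventually_gt_atTop 0] with α hα
  rw [eps_mul_integral_ratio hp0 hα, eps_sq hα.le]
  ring

theorem scaledAction_isLittleO (hp : 1 < p) :
    (fun α => scaledAction p α -
      (E0 p + E1 p * α ^ (1 - p) + (E4 p * α ^ (2 * (1 - p)) + E2 p α * α ^ (-p))))
      =o[atTop] errorScale p := by
  have hp0 : 0 ≤ p := by linarith
  have hgap : ContinuousOn (gap p) (Ioo 0 1) := (continuous_gap hp0).continuousOn
  have hgap1 : ∀ s ∈ Ioo (0 : ℝ) 1, |gap p s| ≤ 1 := fun s hs => by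
    rw [abs_of_pos (gap_pos hp0 hs)]
    exact gap_le_one hs.1.le
  have hTaylor : (fun α => scaledAction p α - (E0 p +
      1 / 2 * (eps p α * ∫ s, ratio p α s * gap p s ∂arcsineMeasure p) +
      -(1 / 8) * (eps p α ^ 2 * ∫ s, ratio p α s ^ 2 * gap p s ∂arcsineMeasure p)))
      =o[atTop] errorScale p := by
    refine isLittleO_of_abs_sub_le ?_ (eps_pow_three_isLittleO hp (C0 p))
    filter_upwards [eventually_ge_atTop 0] with α hα
    rw [E0_eq]
    exact abs_integral_comp_mul_sub_le (Φ := fun x => √(1 + x)) hp0 (by fun_prop)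
      (fun x => abs_sqrt_one_add_sub_le) (continuousOn_ratio hp0 α)
      (fun s hs => ratio_mem_Icc hp0 hs α) hgap hgap1 (eps_nonneg hp0 hα)
  have hE4 : Tendsto (fun α => -((p + 1) ^ 2 / 128) *
      (∫ s, ratio p α s ^ 2 * gap p s ∂arcsineMeasure p) - E4 p) atTop (𝓝 0) := by
    have h := (tendsto_integral_ratio_sq_mul hp0 hgap hgap1).const_mul (-((p + 1) ^ 2 / 128))
    rw [← E4_eq hp0] at h
    simpa using h.sub_const (E4 p)
  have hdefect := (tendsto_oscDefect hp0).const_mul (-((p + 1) / 8))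
  rw [mul_zero] at hdefect
  refine ((hTaylor.add (mul_isLittleO_of_tendsto_zero hE4 (rpow_two_mul_one_sub_isBigO p))).add
    (mul_isLittleO_of_tendsto_zero hdefect (rpow_neg_isBigO p))).congr' ?_ .rfl
  filter_upwards [eventually_gt_atTop 0] with α hα
  rw [eps_mul_integral_ratio_mul_gap hp0 hα, eps_sq hα.le]
  ring

theorem mul_sub_isLittleO {T A P Q X Y δ : ℝ → ℝ} {T₀ A₀ : ℝ} {l : Filter ℝ}
    (hT : (fun x => T x - (P x + X x)) =o[l] δ) (hA : (fun x => A x - (Q x + Y x)) =o[l] δ)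
    (hP : Tendsto P l (𝓝 T₀)) (hQ : Tendsto Q l (𝓝 A₀)) (hX : X =O[l] δ) (hY : Y =O[l] δ)
    (hδ : Tendsto δ l (𝓝 0)) :
    (fun x => T x * A x - (P x * Q x + T₀ * Y x + A₀ * X x)) =o[l] δ := by
  have hTP : (fun x => T x - P x) =O[l] δ := (hT.isBigO.add hX).congr_left fun x => by ring
  have hAQ : (fun x => A x - Q x) =O[l] δ := (hA.isBigO.add hY).congr_left fun x => by ring
  have hcross := mul_isLittleO_of_tendsto_zero (hTP.trans_tendsto hδ) hAQ
  have hPY := mul_isLittleO_of_tendsto_zero (by simpa using hP.sub_const T₀) hAQ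
  have hQX := mul_isLittleO_of_tendsto_zero (by simpa using hQ.sub_const A₀) hTP
  refine ((((hcross.add hPY).add hQX).add (hA.const_mul_left T₀)).add
    (hT.const_mul_left A₀)).congr_left fun x => by ring

theorem scaledTime_mul_scaledAction_isLittleO (hp : 1 < p) :
    (fun α => scaledTime p α * scaledAction p α - (G0 p + G1 p α * α ^ (1 - p) +
      G4 p α * α ^ (2 * (1 - p)) + G2 p α * α ^ (-p))) =o[atTop] errorScale p := by
  have hp0 : 0 ≤ p := by linarith
  have hone : ∀ c : ℝ, (fun _ : ℝ => c) =O[atTop] fun _ => (1 : ℝ) := fun c =>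
    isBigO_const_const c one_ne_zero _
  have hsq := rpow_two_mul_one_sub_isBigO p
  have hneg := rpow_neg_isBigO p
  have hC1 : (fun α => C1 p + 1 / 2 * C11 p α) =O[atTop] fun _ => (1 : ℝ) :=
    (hone _).add ((C11_isBigO_one hp0).const_mul_left _)
  have hP := (tendsto_mul_of_isBigO_one hC1 (tendsto_rpow_one_sub hp)).const_add (C0 p)
  have hQ := ((tendsto_rpow_one_sub hp).const_mul (E1 p)).const_add (E0 p)
  simp only [mul_zero, add_zero] at hP hQ
  have hX := (mul_isBigO_of_isBigO_one ((hone (C2 p)).add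
    (((tendsto_C3 hp0).isBigO_one ℝ))) hsq).add
    (mul_isBigO_of_isBigO_one (((C12_isBigO_one hp0).add (C21_isBigO_one hp0)).const_mul_left
      (1 / 2)) hneg)
  have hY := (hsq.const_mul_left (E4 p)).add (mul_isBigO_of_isBigO_one (E2_isBigO_one hp0) hneg)
  refine (mul_sub_isLittleO (scaledTime_isLittleO hp) (scaledAction_isLittleO hp) hP hQ hX hY
    (tendsto_errorScale hp)).congr' ?_ .rfl
  filter_upwards [eventually_ge_atTop 0] with α hα
  rw [G0, G1, G2, G4, mul_comm 2, Real.rpow_mul hα, Real.rpow_two]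
  ring

/-! ### The nonlinearity `v ^ p + v * sin v ^ 2` -/

/-- The nonlinearity `v ^ p + v * sin v ^ 2` of the problem. -/
noncomputable def force (p v : ℝ) : ℝ := v ^ p + v * Real.sin v ^ 2

/-- A primitive of `force p`, without the normalisation `pot p 0 = 0`. -/
noncomputable def pot (p v : ℝ) : ℝ :=
  v ^ (p + 1) / (p + 1) + v ^ 2 / 4 - v * Real.sin (2 * v) / 4 - Real.cos (2 * v) / 8

theorem isPositiveSolution_force_iff {μ : ℝ} {v : ℝ → ℝ} :
    IsPositiveSolution (force p) μ v ↔ IsSolution p μ v :=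
  ⟨fun ⟨h₁, h₂, h₃, h₄, h₅, h₆⟩ => ⟨h₁, h₂, h₃, h₄, h₅, h₆⟩,
    fun ⟨h₁, h₂, h₃, h₄, h₅, h₆⟩ => ⟨h₁, h₂, h₃, h₄, h₅, h₆⟩⟩

theorem hasDerivAt_pot (hp : p + 1 ≠ 0) {v : ℝ} (hv : 0 < v) :
    HasDerivAt (pot p) (force p v) v := by
  have hlin := (hasDerivAt_id v).const_mul 2
  have h := ((((Real.hasDerivAt_rpow_const (p := p + 1) (Or.inl hv.ne')).div_const (p + 1)).add
    (((hasDerivAt_id v).pow 2).div_const 4)).sub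
    (((hasDerivAt_id v).mul hlin.sin).div_const 4)).sub (hlin.cos.div_const 8)
  refine h.congr_deriv ?_
  simp only [id, force, add_sub_cancel_right, mul_div_cancel_left₀ _ hp, Real.sin_sq,
    Real.cos_two_mul]
  norm_num
  ring

theorem force_nonneg {v : ℝ} (hv : 0 ≤ v) : 0 ≤ force p v := by
  unfold force
  positivity

theorem force_pos {v : ℝ} (hv : 0 < v) : 0 < force p v := by
  unfold force
  positivity

theorem contDiff_force (hp : 1 ≤ p) : ContDiff ℝ 1 (force p) := by
  have hpow : ContDiff ℝ 1 fun v : ℝ => v ^ p := by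
    exact_mod_cast Real.contDiff_rpow_const_of_le (n := 1) (by exact_mod_cast hp)
  unfold force
  fun_prop

theorem exists_isSolution (hp : 1 ≤ p) {α : ℝ} (hα : 0 < α) :
    ∃ μ v, IsSolution p μ v ∧ HasSupNorm v α := by
  obtain ⟨K, hK⟩ := (contDiff_force hp).contDiffOn.exists_lipschitzOnWith (s := Icc 0 α)
    one_ne_zero (convex_Icc 0 α) isCompact_Icc
  simpa only [isPositiveSolution_force_iff] using
    exists_isPositiveSolution hα hK (fun y hy => force_nonneg hy.1) (force_pos hα)

theorem pot_sub_pot (hp : 0 ≤ p) {α : ℝ} (hα : 0 < α) (hs : s ∈ Ioo (0 : ℝ) 1) :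
    pot p α - pot p (α * s) =
      α ^ (p + 1) / (p + 1) * (gap p s * (1 + eps p α * ratio p α s)) := by
  have hp1 : p + 1 ≠ 0 := by linarith
  have hpow : α ^ (p + 1) * α ^ (1 - p) = α ^ 2 := by
    rw [← Real.rpow_add hα, ← Real.rpow_two]
    ring_nf
  have hosc := mul_osc hα.ne' s
  calc pot p α - pot p (α * s)
      = α ^ (p + 1) / (p + 1) * gap p s + α ^ 2 / 4 * (1 - s ^ 2) - α / 4 * (α * osc α s) := by
        rw [hosc, pot, pot, gap, Real.mul_rpow hα.le hs.1.le, ← mul_assoc 2 α s]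
        field_simp
        ring
    _ = α ^ (p + 1) / (p + 1) * gap p s + α ^ (p + 1) * α ^ (1 - p) / 4 *
          (1 - s ^ 2 - osc α s) := by
        rw [hpow]
        ring
    _ = α ^ (p + 1) / (p + 1) * (gap p s * (1 + eps p α * ratio p α s)) := by
        have hg := (gap_pos hp hs).ne'
        rw [eps, ratio]
        field_simp

theorem sqrt_pot_sub_pot (hp : 0 ≤ p) {α : ℝ} (hα : 0 < α) (hs : s ∈ Ioo (0 : ℝ) 1) :
    √(pot p α - pot p (α * s)) =
      √(α ^ (p + 1) / (p + 1)) * (√(gap p s) * √(1 + eps p α * ratio p α s)) := by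
  rw [pot_sub_pot hp hα hs, Real.sqrt_mul (by positivity), Real.sqrt_mul (gap_pos hp hs).le]

theorem setIntegral_Ioo_eq_mul {α : ℝ} (hα : 0 ≤ α) (f : ℝ → ℝ) :
    ∫ y in Ioo 0 α, f y = α * ∫ s in Ioo (0 : ℝ) 1, f (α * s) := by
  rw [← intervalIntegral_zero_one_eq_setIntegral_Ioo, intervalIntegral.mul_integral_comp_mul_left,
    mul_zero, mul_one, intervalIntegral.integral_of_le hα, integral_Ioc_eq_integral_Ioo]

theorem timeMap_pot (hp : 0 ≤ p) {α : ℝ} (hα : 0 < α) :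
    timeMap (pot p) α = α * ((√(α ^ (p + 1) / (p + 1)))⁻¹ * scaledTime p α) := by
  rw [timeMap, setIntegral_Ioo_eq_mul hα.le, scaledTime, integral_arcsineMeasure]
  congr 1
  rw [← integral_const_mul]
  refine setIntegral_congr_fun measurableSet_Ioo fun s hs => ?_
  simp only [sqrt_pot_sub_pot hp hα hs, weight, one_div, mul_inv]
  ring

theorem action_pot (hp : 0 ≤ p) {α : ℝ} (hα : 0 < α) :
    action (pot p) α = α * (√(α ^ (p + 1) / (p + 1)) * scaledAction p α) := by
  rw [action, setIntegral_Ioo_eq_mul hα.le, scaledAction, integral_arcsineMeasure]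
  congr 1
  rw [← integral_const_mul]
  refine setIntegral_congr_fun measurableSet_Ioo fun s hs => ?_
  simp only [sqrt_pot_sub_pot hp hα hs, mul_assoc, gap_mul_weight]
  ring

theorem energy_eq_scaledTime_mul_scaledAction (hp : 0 ≤ p) {α μ : ℝ} {v : ℝ → ℝ} (hα : 0 < α)
    (h : IsSolution p μ v) (hv : HasSupNorm v α) :
    energy v = 4 * α ^ 2 * (scaledTime p α * scaledAction p α) := by
  have hK : √(α ^ (p + 1) / (p + 1)) ≠ 0 := by positivity
  rw [(isPositiveSolution_force_iff.2 h).energy_eq hv (fun _ => force_pos)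
    fun _ => hasDerivAt_pot (by linarith), timeMap_pot hp hα, action_pot hp hα]
  field_simp

theorem errorScale_isBigO (hp : p ≤ 2) :
    errorScale p =O[atTop] fun α => α ^ (2 * (1 - p)) := by
  refine .of_bound 2 ?_
  filter_upwards [eventually_ge_atTop 1] with α hα
  have hle : α ^ (-p) ≤ α ^ (2 * (1 - p)) :=
    Real.rpow_le_rpow_of_exponent_le hα (by linarith)
  rw [errorScale, Real.norm_of_nonneg (by positivity), Real.norm_of_nonneg (by positivity)]
  linarith

end OscBif

open OscBif in
theorem theorem1p5_general {p : ℝ} (hp : 1 < p) :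
    (∀ α : ℝ, 0 < α → ∃ (μ : ℝ) (v : ℝ → ℝ), IsSolution p μ v ∧ HasSupNorm v α) ∧
      ∃ R : ℝ → ℝ, R =o[atTop] (fun α : ℝ => α ^ (2 * (1 - p)) + α ^ (-p)) ∧
        ∀ α : ℝ, 0 < α → ∀ (μ : ℝ) (v : ℝ → ℝ), IsSolution p μ v → HasSupNorm v α →
          energy v = 4 * α ^ 2 * (G0 p + G1 p α * α ^ (1 - p) + G4 p α * α ^ (2 * (1 - p)) +
            G2 p α * α ^ (-p) + R α) := by
  refine ⟨fun α => exists_isSolution hp.le, _, scaledTime_mul_scaledAction_isLittleO hp,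
    fun α hα μ v h hv => ?_⟩
  rw [energy_eq_scaledTime_mul_scaledAction (by linarith) hα h hv, add_sub_cancel]

theorem theorem1p5 :
    -- for every `α > 0` there is a solution pair with `‖v‖_∞ = α`
    (∀ p : ℝ, 1 < p → p ≤ 2 → ∀ α : ℝ, 0 < α →
      ∃ (μ : ℝ) (v : ℝ → ℝ), OscBif.IsSolution p μ v ∧ OscBif.HasSupNorm v α) ∧
    -- the case `1 < p < 2`
    (∀ p : ℝ, 1 < p → p < 2 →
      ∃ R : ℝ → ℝ, R =o[atTop] (fun α : ℝ => α ^ (2 * (1 - p))) ∧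
        ∀ α : ℝ, 0 < α → ∀ (μ : ℝ) (v : ℝ → ℝ),
          OscBif.IsSolution p μ v → OscBif.HasSupNorm v α →
          OscBif.energy v = 4 * α ^ 2 *
            (OscBif.G0 p + OscBif.G1 p α * α ^ (1 - p) + OscBif.G4 p α * α ^ (2 * (1 - p))
              + OscBif.G2 p α * α ^ (-p) + R α)) ∧
    -- the case `p = 2`
    (∃ R : ℝ → ℝ, R =o[atTop] (fun α : ℝ => α ^ (-2 : ℝ)) ∧
      ∀ α : ℝ, 0 < α → ∀ (μ : ℝ) (v : ℝ → ℝ),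
        OscBif.IsSolution 2 μ v → OscBif.HasSupNorm v α →
        OscBif.energy v = 4 * α ^ 2 *
          (OscBif.G0 2 + OscBif.G1 2 α * α ^ (-1 : ℝ)
            + (OscBif.G2 2 α + OscBif.G4 2 α) * α ^ (-2 : ℝ) + R α)) := by
  refine ⟨fun p hp _ => (theorem1p5_general hp).1, fun p hp hp2 => ?_, ?_⟩
  · obtain ⟨R, hR, hR'⟩ := (theorem1p5_general hp).2
    exact ⟨R, hR.trans_isBigO (OscBif.errorScale_isBigO hp2.le), hR'⟩
  · obtain ⟨R, hR, hR'⟩ := (theorem1p5_general one_lt_two).2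
    have hexp : (1 - 2 : ℝ) = -1 ∧ (2 * (1 - 2) : ℝ) = -2 := by norm_num
    refine ⟨R, by simpa only [hexp.2] using hR.trans_isBigO (OscBif.errorScale_isBigO le_rfl),
      fun α hα μ v h hv => ?_⟩
    rw [hR' α hα μ v h hv, hexp.2, hexp.1]
    ring
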